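/- For $a\in\mathbb{R}$ and $q\in(0,1)$ put $(a;q)_n=\prod_{k=1}^{n}(1-aq^{k-1})$ and $(a;q)_\infty=\prod_{k\ge1}(1-aq^{k-1})$. For $\nu>-1$ let $$J_{\nu}^{(2)}(z;q)=\frac{(q^{\nu+1};q)_{\infty}}{(q;q)_{\infty}}\sum_{n\geq0}\frac{(-1)^{n}\left(\frac{z}{2}\right)^{2n+\nu}}{(q;q)_{n}(q^{\nu+1};q)_{n}}q^{n(n+\nu)}$$ be the Jackson $q$-Bessel function, $c_\nu(q)=(q;q)_\infty/(q^{\nu+1};q)_\infty$, and $$h_{\nu}^{(2)}(z;q)=2^{\nu}c_{\nu}(q)\,z^{1-\frac{\nu}{2}}J_{\nu}^{(2)}(\sqrt{z};q),$$ all powers being principal branches. For a function $f$ that is analytic near $0$ with $f(0)=0$, $f'(0)=1$, its radius of starlikeness $r^*(f)$ is the supremum of all $r>0$ such that $f$ is analytic in $|z|<r$ and $\operatorname{Re}\left(zf'(z)/f(z)\right)>0$ for all $|z|<r$ (the quotient being $1$ at $z=0$). **Theorem.** Let $\nu>-1$ and $q\in(0,1)$. The set of admissible radii for $h_\nu^{(2)}(\cdot;q)$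 is non-empty and bounded above, and the radius of starlikeness $r^*=r^*\left(h_{\nu}^{(2)}(\cdot;q)\right)$ is the smallest positive root $r$ of the equation $$\sqrt{r}\,\left(J_{\nu}^{(2)}\right)'(\sqrt r;q)-(\nu-2)\,J_{\nu}^{(2)}(\sqrt r;q)=0,$$ where the prime denotes the derivative with respect to the first argument. Moreover $$\frac{2(1-q)(1-q^{\nu+1})}{q^{\nu+1}}<r^*<\frac{4(q^{\nu+1}-1)(q^{\nu+2}-1)(1-q^2)}{q^{\nu+1}\left(2q-2q^{\nu+2}+q^{\nu+3}-3q^2+2\right)}$$ and $$\sqrt{\frac{8(q^{\nu+1}-1)^2(1-q^{\nu+2})(q-1)^2(q+1)}{q^{2\nu+2}\left(2q-2q^{\nu+2}+q^{\nu+3}-3q^2+2\right)}}<r^*<\frac{4(q^{\nu+1}-1)(q^{\nu+3}-1)(q^3-1)}{q^{\nu+1}}\cdot\frac{2q-2q^{\nu+2}+q^{\nu+3}-3q^2+2}{C_{\nu}(q)+D_{\nu}(q)},$$ where $$C_{\nu}(q)=4q^{\nu+2}+3q^{\nu+3}+7q^{\nu+4}-6q^{\nu+5}-5q^{\nu+6}+3q^{\nu+7}-4q^{2\nu+5}+q^{2\nu+6},$$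 $$D_{\nu}(q)=q^{2\nu+7}-q^{2\nu+8}-8q+q^2+5q^3+9q^4-6q^6-4.$$ -/

import Mathlib

/-- The finite `q`-shifted factorial `(a;q)_n = ∏_{k=1}^{n} (1 - a q^{k-1})`. -/
noncomputable def qPochhammer (a q : ℝ) (n : ℕ) : ℝ :=
  ∏ k ∈ Finset.range n, (1 - a * q ^ k)

/-- The infinite `q`-shifted factorial `(a;q)_∞ = ∏_{k ≥ 1} (1 - a q^{k-1})`. -/
noncomputable def qPochhammerInf (a q : ℝ) : ℝ :=
  ∏' k : ℕ, (1 - a * q ^ k)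

/-- The Jackson (second) `q`-Bessel function `J_ν^{(2)}(z;q)`, with principal branches of the
powers `(z/2)^{2n+ν}`. -/
noncomputable def jacksonBessel (ν q : ℝ) (z : ℂ) : ℂ :=
  ((qPochhammerInf (q ^ (ν + 1)) q / qPochhammerInf q q : ℝ) : ℂ) *
    ∑' n : ℕ, (-1 : ℂ) ^ n * (z / 2) ^ (2 * (n : ℂ) + (ν : ℂ)) /
        ((qPochhammer q q n * qPochhammer (q ^ (ν + 1)) q n : ℝ) : ℂ) *
      ((q ^ ((n : ℝ) * ((n : ℝ) + ν)) : ℝ) : ℂ)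

/-- The normalizing constant `c_ν(q) = (q;q)_∞ / (q^{ν+1};q)_∞`. -/
noncomputable def qBesselConst (ν q : ℝ) : ℝ :=
  qPochhammerInf q q / qPochhammerInf (q ^ (ν + 1)) q

/-- The normalized function
`h_ν^{(2)}(z;q) = 2^ν c_ν(q) z^{1-ν/2} J_ν^{(2)}(√z;q)` (principal branches). -/
noncomputable def hJackson (ν q : ℝ) (z : ℂ) : ℂ :=
  (((2 : ℝ) ^ ν * qBesselConst ν q : ℝ) : ℂ) * z ^ (1 - (ν : ℂ) / 2) *
    jacksonBessel ν q (z ^ (1 / 2 : ℂ))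

/-- `f` belongs to the class `𝒜` on the disk `|z| < r`: it is analytic there and satisfies
`f 0 = 0`, `f' 0 = 1`. -/
def IsNormalizedOn (f : ℂ → ℂ) (r : ℝ) : Prop :=
  DifferentiableOn ℂ f (Metric.ball 0 r) ∧ f 0 = 0 ∧ deriv f 0 = 1

/-- The radii `r > 0` such that `f` is of class `𝒜` on `|z| < r` and `Re (z f'(z) / f(z)) > 0`
there. At the removable singularity `z = 0` the quotient `z f'(z) / f(z)` has the value `1`,
so the condition is only written for `z ≠ 0`. -/
def starlikeRadii (f : ℂ → ℂ) : Set ℝ :=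
  {r | 0 < r ∧ IsNormalizedOn f r ∧
    ∀ z ∈ Metric.ball (0 : ℂ) r, z ≠ 0 → 0 < (z * deriv f z / f z).re}

/-- The radius of starlikeness `r^*(f)`. -/
noncomputable def radiusOfStarlikeness (f : ℂ → ℂ) : ℝ :=
  sSup (starlikeRadii f)

/-- The polynomial `2q - 2q^{ν+2} + q^{ν+3} - 3q^2 + 2` in `q` and `q^ν`. -/
noncomputable def boundPoly (ν q : ℝ) : ℝ :=
  2 * q - 2 * q ^ (ν + 2) + q ^ (ν + 3) - 3 * q ^ 2 + 2

/-- The first part of the denominator in the sharper upper bound. -/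
noncomputable def boundDenomC (ν q : ℝ) : ℝ :=
  4 * q ^ (ν + 2) + 3 * q ^ (ν + 3) + 7 * q ^ (ν + 4) - 6 * q ^ (ν + 5) - 5 * q ^ (ν + 6)
    + 3 * q ^ (ν + 7) - 4 * q ^ (2 * ν + 5) + q ^ (2 * ν + 6)

/-- The second part of the denominator in the sharper upper bound. -/
noncomputable def boundDenomD (ν q : ℝ) : ℝ :=
  q ^ (2 * ν + 7) - q ^ (2 * ν + 8) - 8 * q + q ^ 2 + 5 * q ^ 3 + 9 * q ^ 4 - 6 * q ^ 6 - 4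

/-- The factor `q_2^*(ν)` of the sharper upper bound. -/
noncomputable def qTwoStar (ν q : ℝ) : ℝ :=
  boundPoly ν q / (boundDenomC ν q + boundDenomD ν q)

/-! Write h(z) = z f(z) with f entire, f(0) = 1, and put b = q^(ν+1). If the zeros of f and of h'
are positive, f'/f = -S, where S has the power sums of the reciprocal zeros of f as its
(nonnegative) coefficients. Hence z h'/h = 1 - z S(z) has real part at least 1 - |z| S(|z|) =
h'(|z|)/f(|z|), which is positive until |z| reaches the first positive zero 1/t of h'. There the
quotient vanishes, so r* = 1/t. The root equation is h'(r) = 0 up to a nonvanishing factor.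

For the power sums σ m of h', the Euler–Rayleigh inequalities σ_m^(-1/(m+1)) < 1/t < σ_m/σ_(m+1)
with m = 0, 1 are the four bounds. Newton's identities compute σ 0, σ 1, σ 2 from the coefficients.

No Hadamard factorization is used. The coefficients of f are limits of those of polynomials with
positive zeros (`isPosRootedLimit_qBessel`), built from 1 by two q-difference operators which keep
the zeros positive and separated by a factor 1/q. Rolle's theorem carries the property over to h'.
Newton's identities make the power sums converge, and log-convexity and submultiplicativity survive
in the limit (`IsPosRootedLimit.exists_powerSum`). Then t is defined as the limit of σ_(m+1)/σ_m;
the equation f' = -f S shows that 1/t is the first zero (`HasTopReciprocalZero.ne_zero`,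
`HasTopReciprocalZero.eq_zero`). The bounds are strict because the coefficients decay too fast for
geometric power sums (`IsAlternatingRapid.not_geometric`). -/

open Polynomial Filter Topology Finset

/-! ### Newton's identities and power sums under coefficientwise limits -/

/-- `s` is the coefficient sequence of the negated logarithmic derivative of the power series with
coefficient sequence `c`. -/
def IsLogDeriv (c s : ℕ → ℝ) : Prop :=
  ∀ m : ℕ, ((m : ℝ) + 1) * c (m + 1) = -∑ p ∈ antidiagonal m, c p.1 * s p.2

/-- A polynomial `∏ (1 - x_i X)` with all `x_i > 0`. -/
def IsPosRooted (p : ℝ[X]) : Prop :=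
  ∃ (n : ℕ) (x : Fin n → ℝ), (∀ i, 0 < x i) ∧ p = ∏ i, (1 - C (x i) * X)

/-- A sequence that is a coefficientwise limit of polynomials with positive roots and constant
coefficient `1`. -/
def IsPosRootedLimit (c : ℕ → ℝ) : Prop :=
  ∃ p : ℕ → ℝ[X], (∀ n, IsPosRooted (p n)) ∧
    ∀ k, Tendsto (fun n => (p n).coeff k) atTop (𝓝 (c k))

/-- The properties of the power sums `s m = ∑ x_i ^ (m + 1)` of positive numbers that are kept
under limits. -/
structure IsPowerSumLike (s : ℕ → ℝ) : Prop where
  nonneg : ∀ m, 0 ≤ s m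
  sq_le : ∀ m, s (m + 1) ^ 2 ≤ s m * s (m + 2)
  add_le : ∀ i j, s (i + j + 1) ≤ s i * s j

/-- The geometric series gives the logarithmic derivative of one factor, and logarithmic derivatives
add over products. Comparing coefficients yields Newton's identities. -/
theorem derivative_prod_one_sub {ι : Type*} (u : Finset ι) (x : ι → ℝ) :
    PowerSeries.derivative ℝ ((∏ i ∈ u, (1 - C (x i) * X) : ℝ[X]) : PowerSeries ℝ) =
      -(((∏ i ∈ u, (1 - C (x i) * X) : ℝ[X]) : PowerSeries ℝ) *
        PowerSeries.mk fun m => ∑ i ∈ u, x i ^ (m + 1)) := by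
  classical
  induction u using Finset.induction_on with
  | empty =>
    have : (PowerSeries.mk fun m => ∑ i ∈ (∅ : Finset ι), x i ^ (m + 1)) = 0 := by
      ext m; simp
    rw [this]
    simp
  | insert a u ha ih =>
    have hsum : (PowerSeries.mk fun m => ∑ i ∈ insert a u, x i ^ (m + 1)) =
        (PowerSeries.mk fun m => x a ^ (m + 1)) + PowerSeries.mk fun m => ∑ i ∈ u, x i ^ (m + 1) := by
      ext m; simp [Finset.sum_insert ha]
    have hgeom : (1 - PowerSeries.C (x a) * PowerSeries.X) * (PowerSeries.mk fun m => x a ^ (m + 1))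
        = PowerSeries.C (x a) := by
      ext m
      rw [sub_mul, one_mul, mul_assoc, map_sub, PowerSeries.coeff_C_mul]
      cases m with
      | zero => simp
      | succ m =>
        rw [PowerSeries.coeff_succ_X_mul]
        simp [pow_succ]; ring
    have hd : PowerSeries.derivative ℝ (1 - PowerSeries.C (x a) * PowerSeries.X) =
        -PowerSeries.C (x a) := by
      ext m
      rw [PowerSeries.coeff_derivative]
      cases m <;> simp [PowerSeries.coeff_C, PowerSeries.coeff_one]
    rw [Finset.prod_insert ha, hsum]
    simp only [Polynomial.coe_mul, Polynomial.coe_sub, Polynomial.coe_one, Polynomial.coe_C,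
      Polynomial.coe_X]
    rw [Derivation.leibniz, ih, hd]
    simp only [smul_eq_mul]
    linear_combination (((∏ i ∈ u, (1 - C (x i) * X) : ℝ[X]) : PowerSeries ℝ)) * hgeom

theorem isLogDeriv_prod {n : ℕ} (x : Fin n → ℝ) :
    IsLogDeriv (fun k => (∏ i, (1 - C (x i) * X) : ℝ[X]).coeff k)
      (fun m => ∑ i, x i ^ (m + 1)) := by
  intro m
  have h := congrArg (PowerSeries.coeff m) (derivative_prod_one_sub Finset.univ x)
  rw [PowerSeries.coeff_derivative, map_neg, PowerSeries.coeff_mul] at h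
  simp only [Polynomial.coeff_coe, PowerSeries.coeff_mk] at h
  linarith

/-- Log-convexity is Cauchy–Schwarz. Submultiplicativity holds because, the terms being positive,
each x_a^(j+1) is at most the whole sum. -/
theorem isPowerSumLike_sum {n : ℕ} {x : Fin n → ℝ} (hx : ∀ i, 0 < x i) :
    IsPowerSumLike (fun m => ∑ i, x i ^ (m + 1)) where
  nonneg m := Finset.sum_nonneg fun i _ => (pow_pos (hx i) _).le
  sq_le m := by
    have h := Finset.sum_sq_le_sum_mul_sum_of_sq_le_mul (Finset.univ : Finset (Fin n))
      (r := fun i => x i ^ (m + 1 + 1)) (f := fun i => x i ^ (m + 1))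
      (g := fun i => x i ^ (m + 2 + 1))
      (fun i _ => (pow_pos (hx i) _).le) (fun i _ => (pow_pos (hx i) _).le)
      (fun i _ => by ring_nf; rfl)
    exact h
  add_le i j := by
    rw [Finset.sum_mul]
    refine Finset.sum_le_sum fun a _ => ?_
    have h1 : x a ^ (i + j + 1 + 1) = x a ^ (i + 1) * x a ^ (j + 1) := by ring
    rw [h1]
    refine mul_le_mul_of_nonneg_left ?_ (pow_pos (hx a) _).le
    exact Finset.single_le_sum (f := fun a => x a ^ (j + 1)) (fun b _ => (pow_pos (hx b) _).le)
      (Finset.mem_univ a)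

theorem IsLogDeriv.eq_sub {c s : ℕ → ℝ} (h : IsLogDeriv c s) (h0 : c 0 = 1) (m : ℕ) :
    s m = -((m : ℝ) + 1) * c (m + 1) - ∑ k ∈ range m, c (k + 1) * s (m - (k + 1)) := by
  have := h m
  rw [Finset.Nat.sum_antidiagonal_eq_sum_range_succ (fun i j => c i * s j),
    Finset.sum_range_succ', h0] at this
  simp only [Nat.sub_zero] at this
  linarith

/-- Newton's identities express each power sum through finitely many coefficients and earlier power
sums, so coefficientwise convergence forces the power sums to converge. Identities and weak
inequalities then pass to the limit, without any control of the zeros themselves. -/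
theorem IsPosRootedLimit.exists_powerSum {c : ℕ → ℝ} (hc : IsPosRootedLimit c) :
    c 0 = 1 ∧ ∃ s, IsLogDeriv c s ∧ IsPowerSumLike s := by
  obtain ⟨p, hp, hlim⟩ := hc
  choose N x hx hpx using hp
  have hlog : ∀ n, IsLogDeriv (fun k => (p n).coeff k) (fun m => ∑ i, x n i ^ (m + 1)) := by
    intro n; rw [hpx n]; exact isLogDeriv_prod (x n)
  have hone : ∀ n, (p n).coeff 0 = 1 := by
    intro n
    rw [hpx n, Polynomial.coeff_zero_eq_eval_zero, Polynomial.eval_prod]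
    simp
  have hc0 : c 0 = 1 :=
    tendsto_nhds_unique (hlim 0) (by simp only [hone]; exact tendsto_const_nhds)
  have hex : ∀ m, ∃ l, Tendsto (fun n => ∑ i, x n i ^ (m + 1)) atTop (𝓝 l) := by
    intro m
    induction m using Nat.strong_induction_on with
    | _ m ih =>
      choose! l hl using ih
      refine ⟨-((m : ℝ) + 1) * c (m + 1) - ∑ k ∈ range m, c (k + 1) * l (m - (k + 1)), ?_⟩
      have : (fun n => ∑ i, x n i ^ (m + 1)) = fun n => -((m : ℝ) + 1) * (p n).coeff (m + 1) -
          ∑ k ∈ range m, (p n).coeff (k + 1) * ∑ i, x n i ^ (m - (k + 1) + 1) := by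
        funext n
        exact (hlog n).eq_sub (hone n) m
      rw [this]
      refine ((hlim _).const_mul _).sub (tendsto_finsetSum _ fun k hk => (hlim _).mul (hl _ ?_))
      have := Finset.mem_range.1 hk
      omega
  choose s hs using hex
  refine ⟨hc0, s, fun m => ?_, ?_, ?_, ?_⟩
  · refine tendsto_nhds_unique ((hlim (m + 1)).const_mul ((m : ℝ) + 1)) ?_
    simp only [fun n => hlog n m]
    exact (tendsto_finsetSum _ fun k _ => (hlim _).mul (hs _)).neg
  · exact fun m => ge_of_tendsto' (hs m) fun n => (isPowerSumLike_sum (hx n)).nonneg m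
  · exact fun m => le_of_tendsto_of_tendsto' ((hs (m + 1)).pow 2) ((hs m).mul (hs (m + 2)))
      fun n => (isPowerSumLike_sum (hx n)).sq_le m
  · exact fun i j => le_of_tendsto_of_tendsto' (hs (i + j + 1)) ((hs i).mul (hs j))
      fun n => (isPowerSumLike_sum (hx n)).add_le i j

/-! ### Polynomials with positive roots: differentiation and rescaling -/

theorem isPosRooted_multiset_prod (M : Multiset ℝ) (hM : ∀ t ∈ M, 0 < t) :
    IsPosRooted (M.map fun t => 1 - C t * X).prod := by
  obtain ⟨l, rfl⟩ : ∃ l : List ℝ, (l : Multiset ℝ) = M := Quot.exists_rep M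
  refine ⟨l.length, fun i => l[i], fun i => hM _ (by simp), ?_⟩
  rw [Multiset.map_coe, Multiset.prod_coe, ← List.prod_ofFn]
  congr 1
  apply List.ext_getElem <;> simp

theorem isPosRooted_of_roots {p : ℝ[X]} (h0 : p.eval 0 = 1) (hcard : p.roots.card = p.natDegree)
    (hpos : ∀ a ∈ p.roots, 0 < a) : IsPosRooted p := by
  have hp := Polynomial.C_leadingCoeff_mul_prod_multiset_X_sub_C hcard
  have key : ∀ M : Multiset ℝ, (∀ a ∈ M, 0 < a) → (M.map fun a => X - C a).prod =
      C (M.map fun a => -a).prod * ((M.map fun a => a⁻¹).map fun t => 1 - C t * X).prod := by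
    intro M
    induction M using Multiset.induction_on with
    | empty => simp
    | cons a M ih =>
      intro hM
      have ha : 0 < a := hM a (by simp)
      simp only [Multiset.map_cons, Multiset.prod_cons, C_mul]
      rw [ih fun b hb => hM b (by simp [hb])]
      have h1 : (X - C a : ℝ[X]) = C (-a) * (1 - C a⁻¹ * X) := by
        have : (C a * C a⁻¹ : ℝ[X]) = 1 := by rw [← C_mul, mul_inv_cancel₀ ha.ne', C_1]
        rw [C_neg]
        linear_combination (-X) * this
      rw [h1]; ring
  rw [key _ hpos, ← mul_assoc, ← C_mul] at hp
  have hone : p.leadingCoeff * (p.roots.map fun a => -a).prod = 1 := by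
    have := congrArg (Polynomial.eval 0) hp
    rw [h0, Polynomial.eval_mul, Polynomial.eval_C, Polynomial.eval_multiset_prod] at this
    simpa using this
  rw [hone, C_1, one_mul] at hp
  rw [← hp]
  refine isPosRooted_multiset_prod _ fun t ht => ?_
  obtain ⟨a, ha, rfl⟩ := Multiset.mem_map.1 ht
  exact inv_pos.2 (hpos a ha)

/-- By Rolle's theorem, differentiating the split polynomial X p loses at most one real root, so the
derivative has as many real roots as its degree. For w ≤ 0 one has p(w) > 0 ≥ p'(w), so p(w) + w
p'(w) > 0 and all roots are positive. -/
theorem IsPosRooted.derivative_X_mul {p : ℝ[X]} (hp : IsPosRooted p) :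
    IsPosRooted (derivative (X * p)) := by
  obtain ⟨n, x, hx, rfl⟩ := hp
  set p : ℝ[X] := ∏ i, (1 - C (x i) * X) with hpdef
  have heval : ∀ w ≤ 0, 0 < (derivative (X * p)).eval w := by
    intro w hw
    have h1 : 0 < p.eval w := by
      rw [hpdef, Polynomial.eval_prod]
      refine Finset.prod_pos fun i _ => ?_
      have := hx i
      simp only [eval_sub, eval_one, eval_mul, eval_C, eval_X]
      nlinarith
    have h2 : (derivative p).eval w ≤ 0 := by
      rw [hpdef, Polynomial.derivative_prod_finset, Polynomial.eval_finsetSum]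
      refine Finset.sum_nonpos fun i _ => ?_
      rw [Polynomial.eval_mul, Polynomial.eval_prod]
      refine mul_nonpos_of_nonneg_of_nonpos (Finset.prod_nonneg fun j _ => ?_) ?_
      · have := hx j
        simp only [eval_sub, eval_one, eval_mul, eval_C, eval_X]
        nlinarith
      · have := hx i
        simp
        exact this.le
    simp only [derivative_mul, derivative_X, one_mul, eval_add, eval_mul, eval_X]
    nlinarith
  have hlin : ∀ i, (1 - C (x i) * X : ℝ[X]) = C (-x i) * (X - C (x i)⁻¹) := by
    intro i
    have : (C (x i) * C (x i)⁻¹ : ℝ[X]) = 1 := by rw [← C_mul, mul_inv_cancel₀ (hx i).ne', C_1]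
    rw [C_neg]
    linear_combination -this
  have hne : p ≠ 0 := by
    intro h
    have : p.eval 0 = 1 := by simp [hpdef, Polynomial.eval_prod]
    rw [h] at this
    simp at this
  have hsplit : (X * p).Splits := by
    refine Polynomial.Splits.X.mul (Polynomial.Splits.prod fun i _ => ?_)
    rw [hlin i]
    exact (Polynomial.Splits.C _).mul (Polynomial.Splits.X_sub_C _)
  have hd0 : derivative (X * p) ≠ 0 := by
    intro h
    have := heval 0 le_rfl
    rw [h] at this
    simp at this
  have hcard := Polynomial.card_roots_le_derivative (X * p)
  rw [← hsplit.natDegree_eq_card_roots] at hcard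
  have hdeg : (derivative (X * p)).natDegree ≤ (X * p).natDegree - 1 :=
    Polynomial.natDegree_derivative_le _
  have hle := Polynomial.card_roots' (derivative (X * p))
  have hpos : 0 < (X * p).natDegree := by
    rw [Polynomial.natDegree_X_mul hne]; omega
  refine isPosRooted_of_roots ?_ (by omega) fun a ha => ?_
  · simp [hpdef, Polynomial.eval_prod]
  · by_contra hcon
    have := heval a (not_lt.1 hcon)
    rw [(Polynomial.mem_roots hd0).1 ha] at this
    exact lt_irrefl _ this

theorem IsPosRooted.comp_C_mul_X {p : ℝ[X]} (hp : IsPosRooted p) {κ : ℝ} (hκ : 0 < κ) :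
    IsPosRooted (p.comp (C κ * X)) := by
  obtain ⟨n, x, hx, rfl⟩ := hp
  refine ⟨n, fun i => x i * κ, fun i => mul_pos (hx i) hκ, ?_⟩
  rw [Polynomial.prod_comp]
  refine Finset.prod_congr rfl fun i _ => ?_
  simp only [sub_comp, one_comp, mul_comp, C_comp, X_comp, C_mul]
  ring

theorem IsPosRootedLimit.mul_pow {c : ℕ → ℝ} (hc : IsPosRootedLimit c) {κ : ℝ} (hκ : 0 < κ) :
    IsPosRootedLimit (fun k => c k * κ ^ k) := by
  obtain ⟨p, hp, hlim⟩ := hc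
  refine ⟨fun n => (p n).comp (C κ * X), fun n => (hp n).comp_C_mul_X hκ, fun k => ?_⟩
  simp only [Polynomial.comp_C_mul_X_coeff]
  exact (hlim k).mul_const _

theorem IsPosRootedLimit.succ_mul {c : ℕ → ℝ} (hc : IsPosRootedLimit c) :
    IsPosRootedLimit (fun k => ((k : ℝ) + 1) * c k) := by
  obtain ⟨p, hp, hlim⟩ := hc
  refine ⟨fun n => derivative (X * p n), fun n => (hp n).derivative_X_mul, fun k => ?_⟩
  simp only [Polynomial.coeff_derivative, Polynomial.coeff_X_mul]
  simpa [mul_comm] using (hlim k).const_mul ((k : ℝ) + 1)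

/-! ### q-separated zeros and two q-difference operators that preserve them -/

theorem natDegree_C_mul_X_le (c : ℝ) : (C c * X : ℝ[X]).natDegree ≤ 1 :=
  (Polynomial.natDegree_C_mul_le _ _).trans Polynomial.natDegree_X_le

/-- `p = ∏_{i < n} (1 - X / x_i)` where the `x_i > 0` increase at least by the factor `1 / q`. -/
structure IsSeparated (q : ℝ) (n : ℕ) (p : ℝ[X]) (x : ℕ → ℝ) : Prop where
  pos : ∀ i < n, 0 < x i
  sep : ∀ i, i + 1 < n → x i ≤ q * x (i + 1)
  eval : ∀ w, p.eval w = ∏ i ∈ range n, (1 - w / x i)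

theorem IsSeparated.isPosRooted {q : ℝ} {n : ℕ} {p : ℝ[X]} {x : ℕ → ℝ}
    (h : IsSeparated q n p x) : IsPosRooted p := by
  refine ⟨n, fun i => (x i)⁻¹, fun i => inv_pos.2 (h.pos i i.2), Polynomial.funext fun w => ?_⟩
  rw [h.eval, Polynomial.eval_prod, ← Fin.prod_univ_eq_prod_range (fun i => 1 - w / x i)]
  refine Finset.prod_congr rfl fun i _ => ?_
  simp only [eval_sub, eval_one, eval_mul, eval_C, eval_X]
  ring

theorem IsSeparated.mono {q : ℝ} (hq1 : q < 1) {n : ℕ} {p : ℝ[X]} {x : ℕ → ℝ}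
    (h : IsSeparated q n p x) {i j : ℕ} (hij : i ≤ j) (hj : j < n) : x i ≤ x j := by
  induction j, hij using Nat.le_induction with
  | base => exact le_rfl
  | succ j hij ih =>
    have h1 := ih (by omega)
    have h2 := h.sep j hj
    have h3 := h.pos (j + 1) hj
    nlinarith

theorem IsSeparated.le_mul {q : ℝ} (hq1 : q < 1) {n : ℕ} {p : ℝ[X]} {x : ℕ → ℝ}
    (h : IsSeparated q n p x) {i j : ℕ} (hij : i < j) (hj : j < n) : x i ≤ q * x j := by
  obtain ⟨k, rfl⟩ : ∃ k, j = k + 1 := ⟨j - 1, by omega⟩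
  exact (h.mono hq1 (by omega : i ≤ k) (by omega)).trans (h.sep k hj)

theorem IsSeparated.sign {q : ℝ} {n : ℕ} {p : ℝ[X]} {x : ℕ → ℝ}
    (h : IsSeparated q n p x) {j : ℕ} (hj : j ≤ n) {w : ℝ} (hlo : ∀ i < j, x i ≤ w)
    (hhi : ∀ i, j ≤ i → i < n → w ≤ x i) : 0 ≤ (-1) ^ j * p.eval w := by
  rw [h.eval, ← Finset.prod_range_mul_prod_Ico _ hj, ← mul_assoc]
  refine mul_nonneg ?_ (Finset.prod_nonneg fun i hi => ?_)
  · rw [← Finset.card_range j, ← Finset.prod_const, Finset.card_range, ← Finset.prod_mul_distrib]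
    refine Finset.prod_nonneg fun i hi => ?_
    have hi := Finset.mem_range.1 hi
    have : 1 ≤ w / x i := (one_le_div (h.pos i (by omega))).2 (hlo i hi)
    linarith
  · obtain ⟨h1, h2⟩ := Finset.mem_Ico.1 hi
    have : w / x i ≤ 1 := (div_le_one (h.pos i h2)).2 (hhi i h1 h2)
    linarith

/-- The intermediate value theorem yields a zero in each of the m intervals, and the gaps between
intervals separate the zeros. Together with the value 1 at 0 these are m + 1 interpolation points,
which determine a polynomial of degree at most m. -/
theorem exists_isSeparated {q : ℝ} (hq1 : q < 1) {m : ℕ} {p : ℝ[X]}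
    (hdeg : p.natDegree ≤ m) (h0 : p.eval 0 = 1) (lo hi : ℕ → ℝ) (hlo : ∀ i < m, 0 ≤ lo i)
    (hle : ∀ i < m, lo i ≤ hi i) (hslo : ∀ i < m, 0 ≤ (-1) ^ i * p.eval (lo i))
    (hshi : ∀ i < m, (-1) ^ i * p.eval (hi i) ≤ 0)
    (hsep : ∀ i, i + 1 < m → hi i ≤ q * lo (i + 1)) : ∃ x, IsSeparated q m p x := by
  have hroot : ∀ i, ∃ y, i < m → lo i ≤ y ∧ y ≤ hi i ∧ p.eval y = 0 := by
    intro i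
    by_cases him : i < m
    · have hcont : ContinuousOn (fun w => (-1 : ℝ) ^ i * p.eval w) (Set.Icc (lo i) (hi i)) :=
        (p.continuous.const_mul _).continuousOn
      obtain ⟨y, hy, hy0⟩ := intermediate_value_Icc' (hle i him) hcont
        ⟨hshi i him, hslo i him⟩
      refine ⟨y, fun _ => ⟨hy.1, hy.2, ?_⟩⟩
      simpa using hy0
    · exact ⟨0, fun h => absurd h him⟩
  choose y hy using hroot
  have hpos : ∀ i < m, 0 < y i := by
    intro i him
    obtain ⟨h1, -, h3⟩ := hy i him
    rcases ((hlo i him).trans h1).lt_or_eq with h | h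
    · exact h
    · rw [← h, h0] at h3; exact absurd h3 one_ne_zero
  have hysep : ∀ i, i + 1 < m → y i ≤ q * y (i + 1) := by
    intro i him
    have hpos' := hpos i (by omega)
    have h1 := (hy i (by omega)).2.1.trans (hsep i him)
    have h2 := (hy (i + 1) him).1
    have h3 := hpos (i + 1) him
    have h4 := hlo (i + 1) him
    rcases le_or_gt 0 q with hq | hq
    · nlinarith
    · nlinarith
  have hstrict : ∀ i j, i < j → j < m → y i < y j := by
    intro i j hij
    induction j, hij using Nat.le_induction with
    | base =>
      intro hj
      have h1 := hysep i hj
      have h2 := hpos (i + 1) hj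
      simp only [Nat.succ_eq_add_one]
      nlinarith
    | succ j hij ih =>
      intro hj
      have h1 := hysep j hj
      have h2 := hpos (j + 1) hj
      have h3 := ih (by omega)
      nlinarith
  have hinj : Set.InjOn y (range m : Finset ℕ) := by
    intro i hi j hj hij
    have hi := Finset.mem_range.1 hi
    have hj := Finset.mem_range.1 hj
    rcases lt_trichotomy i j with h | h | h
    · exact absurd hij (hstrict i j h hj).ne
    · exact h
    · exact absurd hij (hstrict j i h hi).ne'
  refine ⟨y, hpos, hysep, ?_⟩
  have heq : p = ∏ i ∈ range m, (1 - C (y i)⁻¹ * X) := by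
    have h0mem : (0 : ℝ) ∉ (range m).image y := by
      intro h
      obtain ⟨i, hi, h⟩ := Finset.mem_image.1 h
      exact (hpos i (Finset.mem_range.1 hi)).ne' h
    have hcard : (insert (0 : ℝ) ((range m).image y)).card = m + 1 := by
      rw [Finset.card_insert_of_notMem h0mem, Finset.card_image_of_injOn hinj, Finset.card_range]
    have hdeg2 : (∏ i ∈ range m, (1 - C (y i)⁻¹ * X) : ℝ[X]).natDegree ≤ m := by
      refine (Polynomial.natDegree_prod_le _ _).trans ?_
      refine (Finset.sum_le_sum (g := fun _ => 1) fun i _ => ?_).trans (by simp)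
      exact (Polynomial.natDegree_sub_le _ _).trans
        (max_le (by simp) (natDegree_C_mul_X_le _))
    refine Polynomial.eq_of_degrees_lt_of_eval_finset_eq (insert (0 : ℝ) ((range m).image y))
      ?_ ?_ ?_
    · rw [hcard]
      exact (Polynomial.degree_le_of_natDegree_le hdeg).trans_lt (by exact_mod_cast m.lt_succ_self)
    · rw [hcard]
      exact (Polynomial.degree_le_of_natDegree_le hdeg2).trans_lt (by exact_mod_cast m.lt_succ_self)
    · intro w hw
      rcases Finset.mem_insert.1 hw with rfl | hw
      · rw [h0, Polynomial.eval_prod]; simp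
      · obtain ⟨i, hi, rfl⟩ := Finset.mem_image.1 hw
        have him := Finset.mem_range.1 hi
        rw [(hy i him).2.2, Polynomial.eval_prod]
        symm
        refine Finset.prod_eq_zero hi ?_
        simp [inv_mul_cancel₀ (hpos i him).ne']
  intro w
  conv_lhs => rw [heq]
  rw [Polynomial.eval_prod]
  refine Finset.prod_congr rfl fun i _ => ?_
  simp only [eval_sub, eval_one, eval_mul, eval_C, eval_X]
  ring

/-- The operator `p ↦ p (q X) - q X p (q² X)`. -/
noncomputable def qShiftRaise (q : ℝ) (p : ℝ[X]) : ℝ[X] :=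
  p.comp (C q * X) - C q * X * p.comp (C (q ^ 2) * X)

/-- The operator `p ↦ (p - c p (q X)) / (1 - c)`. -/
noncomputable def qShiftDiff (q c : ℝ) (p : ℝ[X]) : ℝ[X] :=
  C (1 - c)⁻¹ * (p - C c * p.comp (C q * X))

theorem eval_qShiftRaise (q : ℝ) (p : ℝ[X]) (w : ℝ) :
    (qShiftRaise q p).eval w = p.eval (q * w) - q * w * p.eval (q ^ 2 * w) := by
  simp [qShiftRaise]

theorem eval_qShiftDiff (q c : ℝ) (p : ℝ[X]) (w : ℝ) :
    (qShiftDiff q c p).eval w = (1 - c)⁻¹ * (p.eval w - c * p.eval (q * w)) := by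
  simp [qShiftDiff]

theorem natDegree_comp_C_mul_X_le (c : ℝ) (p : ℝ[X]) :
    (p.comp (C c * X)).natDegree ≤ p.natDegree :=
  Polynomial.natDegree_comp_le.trans
    ((Nat.mul_le_mul_left _ (natDegree_C_mul_X_le c)).trans (mul_one _).le)

/-- The i-th new zero lies between x_(i-1)/q (or 0) and x_i. At the left end the second term drops
and p(x_(i-1)/q) remains; at the right end a nonpositive multiple of p(q x_i) remains. By separation
both arguments lie between x_(i-1) and x_i, where p has sign (-1)^i. -/
theorem IsSeparated.qShiftDiff {q : ℝ} (hq0 : 0 < q) (hq1 : q < 1) {c : ℝ} (hc0 : 0 ≤ c)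
    (hc1 : c < 1) {n : ℕ} {p : ℝ[X]} (hdeg : p.natDegree ≤ n) {x : ℕ → ℝ}
    (h : IsSeparated q n p x) :
    (qShiftDiff q c p).natDegree ≤ n ∧ ∃ y, IsSeparated q n (qShiftDiff q c p) y := by
  have hdeg' : (_root_.qShiftDiff q c p).natDegree ≤ n := by
    refine (Polynomial.natDegree_C_mul_le _ _).trans ?_
    refine (Polynomial.natDegree_sub_le _ _).trans (max_le hdeg ?_)
    exact (Polynomial.natDegree_C_mul_le _ _).trans ((natDegree_comp_C_mul_X_le _ _).trans hdeg)
  have hinv : 0 < (1 - c)⁻¹ := inv_pos.2 (by linarith)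
  have h0 : p.eval 0 = 1 := by simp [h.eval]
  have hz : ∀ i < n, p.eval (x i) = 0 := by
    intro i hi
    rw [h.eval]
    exact Finset.prod_eq_zero (Finset.mem_range.2 hi) (by rw [div_self (h.pos i hi).ne', sub_self])
  refine ⟨hdeg', exists_isSeparated hq1 hdeg' ?_ (fun i => if i = 0 then 0 else x (i - 1) / q) x
    ?_ ?_ ?_ ?_ ?_⟩
  · rw [eval_qShiftDiff, mul_zero, h0, mul_one, inv_mul_cancel₀ (by linarith)]
  · intro i hi
    by_cases h : i = 0
    · simp [h]
    · simp only [h, if_false]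
      exact div_nonneg (IsSeparated.pos ‹_› _ (by omega)).le hq0.le
  · intro i hi
    by_cases hi0 : i = 0
    · simpa [hi0] using (h.pos 0 (by omega)).le
    · simp only [hi0, if_false]
      rw [div_le_iff₀' hq0]
      exact h.le_mul hq1 (by omega) hi
  · intro i hi
    by_cases hi0 : i = 0
    · simp only [hi0, if_true]
      rw [eval_qShiftDiff, mul_zero, h0, mul_one, inv_mul_cancel₀ (by linarith)]; simp
    · simp only [hi0, if_false]
      rw [eval_qShiftDiff, mul_div_cancel₀ _ hq0.ne', hz _ (by omega)]
      have := h.sign hi.le (w := x (i - 1) / q) (fun k hk => ?_) (fun k hk hkn => ?_)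
      · rw [mul_zero, sub_zero]
        nlinarith [mul_nonneg hinv.le this]
      · rw [le_div_iff₀' hq0]
        have h1 := h.mono hq1 (by omega : k ≤ i - 1) (by omega)
        have h2 := h.pos k (by omega)
        nlinarith
      · rw [div_le_iff₀' hq0]
        exact h.le_mul hq1 (by omega) hkn
  · intro i hi
    rw [eval_qShiftDiff, hz _ hi]
    have := h.sign hi.le (w := q * x i) (fun k hk => h.le_mul hq1 hk hi) (fun k hk hkn => ?_)
    · nlinarith [mul_nonneg (mul_nonneg hinv.le hc0) this]
    · have h1 := h.mono hq1 hk hkn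
      have h2 := h.pos i hi
      nlinarith
  · intro i hi
    simp [mul_div_cancel₀ _ hq0.ne']

/-- For large w the term q w p(q² w) dominates p(q w). This supplies the right end of the interval
for the one additional zero created by `qShiftRaise`. -/
theorem IsSeparated.exists_raise_sign {q : ℝ} (hq0 : 0 < q) (hq1 : q < 1) {n : ℕ} {p : ℝ[X]}
    {x : ℕ → ℝ} (h : IsSeparated q n p x) (B : ℝ) :
    ∃ w, B ≤ w ∧ (-1) ^ n * (qShiftRaise q p).eval w ≤ 0 := by
  -- The three summands ensure in turn B ≤ w, (2/q)^n ≤ q w, and 2 x_i ≤ q² w for every i. The last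
  -- gives q w/x_i - 1 ≤ (2/q)(q² w/x_i - 1) for each factor.
  set w : ℝ := |B| + (2 / q) ^ n / q + ∑ i ∈ range n, 2 * x i / q ^ 2 with hw
  have hsum : ∀ i ∈ range n, 0 ≤ 2 * x i / q ^ 2 := fun i hi => by
    have := h.pos i (Finset.mem_range.1 hi); positivity
  have hsum0 := Finset.sum_nonneg hsum
  have hpow : 0 < (2 / q) ^ n := by positivity
  have hw1 : (2 / q) ^ n ≤ q * w := by
    have : (2 / q) ^ n / q ≤ w := by have := abs_nonneg B; linarith
    rwa [div_le_iff₀' hq0] at this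
  have hw0 : 0 ≤ w := by have := abs_nonneg B; positivity
  have hwx : ∀ i < n, 2 * x i ≤ q ^ 2 * w := by
    intro i hi
    have h1 := Finset.single_le_sum hsum (Finset.mem_range.2 hi)
    have h2 : 2 * x i / q ^ 2 ≤ w := by
      have := abs_nonneg B
      have : 0 ≤ (2 / q) ^ n / q := by positivity
      linarith
    rwa [div_le_iff₀' (by positivity)] at h2
  refine ⟨w, ?_, ?_⟩
  · have := le_abs_self B
    have : 0 ≤ (2 / q) ^ n / q := by positivity
    linarith
  have hP : ∀ v, (-1) ^ n * p.eval v = ∏ i ∈ range n, (v / x i - 1) := by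
    intro v
    rw [h.eval]
    nth_rewrite 1 [← Finset.card_range n]
    rw [← Finset.prod_const, ← Finset.prod_mul_distrib]
    exact Finset.prod_congr rfl fun i _ => by ring
  have hle : (-1) ^ n * p.eval (q * w) ≤ (2 / q) ^ n * ((-1) ^ n * p.eval (q ^ 2 * w)) := by
    rw [hP, hP]
    nth_rewrite 2 [← Finset.card_range n]
    rw [← Finset.prod_const, ← Finset.prod_mul_distrib]
    refine Finset.prod_le_prod (fun i hi => ?_) fun i hi => ?_
    · have hi := Finset.mem_range.1 hi
      have hx := h.pos i hi
      have h1 := hwx i hi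
      have : 1 ≤ q * w / x i := by
        rw [one_le_div hx]
        nlinarith [mul_nonneg hq0.le hw0]
      linarith
    · have hi := Finset.mem_range.1 hi
      have hx := h.pos i hi
      have h1 : 2 ≤ q ^ 2 * w / x i := (le_div_iff₀ hx).2 (hwx i hi)
      have h2 : q ^ 2 * w / x i = q * (q * w / x i) := by ring
      rw [div_mul_eq_mul_div, le_div_iff₀ hq0]
      rw [h2] at h1 ⊢
      nlinarith
  have hnn : 0 ≤ (-1) ^ n * p.eval (q ^ 2 * w) := by
    refine h.sign le_rfl (fun i hi => ?_) (fun i h1 h2 => by omega)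
    have := h.pos i hi
    linarith [hwx i hi]
  rw [eval_qShiftRaise]
  nlinarith [mul_le_mul_of_nonneg_right hw1 hnn]

/-- The i-th new zero lies between x_(i-1)/q² (or 0) and x_i/q, the last one below a large W. At
these ends one of the two terms drops, leaving p(x_(i-1)/q) and -x_i p(q x_i), whose signs are known
from separation. -/
theorem IsSeparated.qShiftRaise {q : ℝ} (hq0 : 0 < q) (hq1 : q < 1) {n : ℕ} {p : ℝ[X]}
    (hdeg : p.natDegree ≤ n) {x : ℕ → ℝ} (h : IsSeparated q n p x) :
    (qShiftRaise q p).natDegree ≤ n + 1 ∧ ∃ y, IsSeparated q (n + 1) (qShiftRaise q p) y := by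
  have hdeg' : (_root_.qShiftRaise q p).natDegree ≤ n + 1 := by
    refine (Polynomial.natDegree_sub_le _ _).trans (max_le ?_ ?_)
    · exact ((natDegree_comp_C_mul_X_le _ _).trans hdeg).trans (Nat.le_succ _)
    · refine Polynomial.natDegree_mul_le.trans ?_
      rw [add_comm]
      exact add_le_add ((natDegree_comp_C_mul_X_le _ _).trans hdeg)
        (natDegree_C_mul_X_le _)
  have h0 : p.eval 0 = 1 := by simp [h.eval]
  have hz : ∀ i < n, p.eval (x i) = 0 := by
    intro i hi
    rw [h.eval]
    exact Finset.prod_eq_zero (Finset.mem_range.2 hi) (by rw [div_self (h.pos i hi).ne', sub_self])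
  have hq2 : 0 < q ^ 2 := by positivity
  set lo : ℕ → ℝ := fun i => if i = 0 then 0 else x (i - 1) / q ^ 2 with hlo
  obtain ⟨W, hWlo, hW⟩ := h.exists_raise_sign hq0 hq1 (lo n)
  refine ⟨hdeg', exists_isSeparated hq1 hdeg' ?_ lo (fun i => if i = n then W else x i / q)
    ?_ ?_ ?_ ?_ ?_⟩
  · simp [eval_qShiftRaise, h0]
  · intro i hi
    by_cases hi0 : i = 0
    · simp [hlo, hi0]
    · simp only [hlo, hi0, if_false]
      exact div_nonneg (h.pos _ (by omega)).le hq2.le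
  · intro i hi
    by_cases hin : i = n
    · simpa [hin] using hWlo
    · simp only [hin, if_false]
      by_cases hi0 : i = 0
      · simp only [hlo, hi0, if_true]
        exact div_nonneg (h.pos _ (by omega)).le hq0.le
      · simp only [hlo, hi0, if_false]
        rw [div_le_div_iff₀ hq2 hq0]
        have := h.le_mul hq1 (by omega : i - 1 < i) (by omega)
        nlinarith
  · intro i hi
    by_cases hi0 : i = 0
    · simp [hlo, hi0, eval_qShiftRaise, h0]
    · simp only [hlo, hi0, if_false]
      rw [eval_qShiftRaise, mul_div_cancel₀ _ hq2.ne', hz _ (by omega)]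
      have hqw : q * (x (i - 1) / q ^ 2) = x (i - 1) / q := by field_simp
      rw [hqw]
      have := h.sign (by omega : i ≤ n) (w := x (i - 1) / q) (fun k hk => ?_) (fun k hk hkn => ?_)
      · simpa using this
      · rw [le_div_iff₀' hq0]
        have h1 := h.mono hq1 (by omega : k ≤ i - 1) (by omega)
        have h2 := h.pos k (by omega)
        nlinarith
      · rw [div_le_iff₀' hq0]
        exact h.le_mul hq1 (by omega) hkn
  · intro i hi
    by_cases hin : i = n
    · simpa [hin] using hW
    · simp only [hin, if_false]
      have hin' : i < n := by omega
      have hx := h.pos i hin'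
      have hqw : q ^ 2 * (x i / q) = q * x i := by field_simp
      rw [eval_qShiftRaise, mul_div_cancel₀ _ hq0.ne', hz _ hin', hqw]
      have := h.sign hin'.le (w := q * x i) (fun k hk => h.le_mul hq1 hk hin')
        (fun k hk hkn => ?_)
      · nlinarith [mul_nonneg hx.le this]
      · have h1 := h.mono hq1 hk hkn
        nlinarith
  · intro i hi
    have hin : i ≠ n := by omega
    simp only [hlo, hin, if_false, Nat.add_sub_cancel, Nat.add_eq_zero_iff, one_ne_zero, and_false]
    refine le_of_eq ?_
    field_simp

/-! ### Approximation of the q-Bessel series by polynomials with positive roots -/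

/-- The polynomials with coefficients `(-1)^k q^{k²} [n choose k]_q`. -/
noncomputable def stieltjesPoly (q : ℝ) (n : ℕ) : ℝ[X] := (qShiftRaise q)^[n] 1

/-- Applies `qShiftDiff q (b q^j)` for all `j < m`. -/
noncomputable def qShiftDiffIter (q b : ℝ) (p : ℝ[X]) : ℕ → ℝ[X]
  | 0 => p
  | m + 1 => qShiftDiff q (b * q ^ m) (qShiftDiffIter q b p m)

theorem isSeparated_stieltjesPoly {q : ℝ} (hq0 : 0 < q) (hq1 : q < 1) (n : ℕ) :
    (stieltjesPoly q n).natDegree ≤ n ∧ ∃ x, IsSeparated q n (stieltjesPoly q n) x := by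
  induction n with
  | zero => exact ⟨by simp [stieltjesPoly], fun _ => 1, by simp, by simp, by simp [stieltjesPoly]⟩
  | succ n ih =>
    obtain ⟨hdeg, x, hx⟩ := ih
    have : stieltjesPoly q (n + 1) = qShiftRaise q (stieltjesPoly q n) :=
      Function.iterate_succ_apply' _ _ _
    rw [this]
    exact hx.qShiftRaise hq0 hq1 hdeg

theorem isSeparated_qShiftDiffIter {q b : ℝ} (hq0 : 0 < q) (hq1 : q < 1) (hb0 : 0 ≤ b)
    (hb1 : b < 1) {n : ℕ} {p : ℝ[X]} (hdeg : p.natDegree ≤ n) {x : ℕ → ℝ}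
    (h : IsSeparated q n p x) (m : ℕ) :
    (qShiftDiffIter q b p m).natDegree ≤ n ∧ ∃ y, IsSeparated q n (qShiftDiffIter q b p m) y := by
  induction m with
  | zero => exact ⟨hdeg, x, h⟩
  | succ m ih =>
    obtain ⟨hdeg', y, hy⟩ := ih
    have hqm : q ^ m ≤ 1 := pow_le_one₀ hq0.le hq1.le
    exact hy.qShiftDiff hq0 hq1 (by positivity) (by nlinarith [pow_pos hq0 m]) hdeg'

/-- The induction step is the q-Pascal rule. Writing q^n/q^j instead of q^(n-j) covers k > n, where
the factor j = n vanishes, and shows the limit n → ∞ directly. -/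
theorem coeff_stieltjesPoly {q : ℝ} (hq0 : 0 < q) (hq1 : q < 1) (n k : ℕ) :
    (stieltjesPoly q n).coeff k =
      (-1) ^ k * q ^ (k * k) * ∏ j ∈ range k, (1 - q ^ n / q ^ j) / (1 - q * q ^ j) := by
  induction n generalizing k with
  | zero =>
    cases k with
    | zero => simp [stieltjesPoly]
    | succ k =>
      rw [Finset.prod_eq_zero (Finset.mem_range.2 k.succ_pos) (by simp)]
      simp [stieltjesPoly, Polynomial.coeff_one]
  | succ n ih =>
    have hstep : stieltjesPoly q (n + 1) = qShiftRaise q (stieltjesPoly q n) :=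
      Function.iterate_succ_apply' _ _ _
    rw [hstep, qShiftRaise, Polynomial.coeff_sub, Polynomial.comp_C_mul_X_coeff, mul_assoc,
      Polynomial.coeff_C_mul, ih]
    cases k with
    | zero => simp
    | succ k =>
      rw [Polynomial.coeff_X_mul, Polynomial.comp_C_mul_X_coeff, ih]
      have hne : ∀ j, 1 - q * q ^ j ≠ 0 := by
        intro j
        rw [← pow_succ']
        exact (sub_pos.2 (pow_lt_one₀ hq0.le hq1 j.succ_ne_zero)).ne'
      rw [Finset.prod_div_distrib, Finset.prod_div_distrib, Finset.prod_div_distrib]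
      have hshift : ∏ j ∈ range (k + 1), (1 - q ^ (n + 1) / q ^ j) =
          (1 - q ^ (n + 1)) * ∏ j ∈ range k, (1 - q ^ n / q ^ j) := by
        rw [Finset.prod_range_succ', mul_comm]
        simp only [pow_zero, div_one]
        congr 1
        refine Finset.prod_congr rfl fun j _ => ?_
        rw [pow_succ, pow_succ, mul_div_mul_right _ _ hq0.ne']
      rw [hshift, Finset.prod_range_succ, Finset.prod_range_succ]
      set N := ∏ j ∈ range k, (1 - q ^ n / q ^ j)
      have hDne : ∏ j ∈ range k, (1 - q * q ^ j) ≠ 0 := Finset.prod_ne_zero_iff.2 fun j _ => hne j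
      set D := ∏ j ∈ range k, (1 - q * q ^ j)
      have := hne k
      have hqk : q ^ k ≠ 0 := pow_ne_zero _ hq0.ne'
      have e1 : q ^ ((k + 1) * (k + 1)) = q ^ (k * k) * (q ^ k) ^ 2 * q := by ring
      have e2 : (q ^ 2) ^ k = (q ^ k) ^ 2 := by ring
      rw [e1, e2, pow_succ q k, pow_succ q n, pow_succ (-1 : ℝ) k]
      generalize q ^ k = Q at *
      generalize q ^ (k * k) = R at *
      generalize q ^ n = U at *
      obtain ⟨V, hV⟩ : ∃ V, V = 1 - q * Q := ⟨_, rfl⟩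
      rw [← hV] at this ⊢
      field_simp
      rw [hV]
      ring

/-- Each operator multiplies the k-th coefficient by (1 - b q^(j+k))/(1 - b q^j). The product over j
< m telescopes to one of k factors, a number independent of m, so that m → ∞ can be taken
factorwise. -/
theorem coeff_qShiftDiffIter {q b : ℝ} (hq0 : 0 < q) (hq1 : q < 1) (hb0 : 0 ≤ b)
    (hb1 : b < 1) (p : ℝ[X]) (m k : ℕ) :
    (qShiftDiffIter q b p m).coeff k =
      (∏ j ∈ range k, (1 - b * q ^ m * q ^ j) / (1 - b * q ^ j)) * p.coeff k := by
  have hne : ∀ j, 1 - b * q ^ j ≠ 0 := by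
    intro j
    have hqm : q ^ j ≤ 1 := pow_le_one₀ hq0.le hq1.le
    nlinarith [pow_pos hq0 j]
  have hprod : (qShiftDiffIter q b p m).coeff k =
      (∏ j ∈ range m, (1 - b * q ^ (j + k)) / (1 - b * q ^ j)) * p.coeff k := by
    induction m with
    | zero => simp [qShiftDiffIter]
    | succ m ih =>
      rw [qShiftDiffIter, qShiftDiff, Polynomial.coeff_C_mul, Polynomial.coeff_sub,
        Polynomial.coeff_C_mul, Polynomial.comp_C_mul_X_coeff, ih, Finset.prod_range_succ,
        pow_add]
      ring
  rw [hprod]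
  congr 1
  rw [Finset.prod_div_distrib, Finset.prod_div_distrib,
    div_eq_div_iff (Finset.prod_ne_zero_iff.2 fun j _ => hne j)
      (Finset.prod_ne_zero_iff.2 fun j _ => hne j)]
  have h1 := Finset.prod_range_add (fun j => 1 - b * q ^ j) m k
  have h2 := Finset.prod_range_add (fun j => 1 - b * q ^ j) k m
  rw [add_comm k m, h1] at h2
  calc _ = (∏ j ∈ range k, (1 - b * q ^ j)) * ∏ j ∈ range m, (1 - b * q ^ (k + j)) := by
        rw [mul_comm]; simp only [add_comm]
    _ = _ := by
        rw [← h2, mul_comm]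
        congr 1
        exact Finset.prod_congr rfl fun j _ => by rw [pow_add, mul_assoc]

/-- The coefficients `(-1)^k q^{k²} / ((q;q)_k (b;q)_k)` of a `q`-Bessel series are a
coefficientwise limit of polynomials with positive roots. -/
theorem isPosRootedLimit_qBessel {q b : ℝ} (hq0 : 0 < q) (hq1 : q < 1) (hb0 : 0 ≤ b)
    (hb1 : b < 1) :
    IsPosRootedLimit fun k => (-1) ^ k * q ^ (k * k) / (qPochhammer q q k * qPochhammer b q k) := by
  refine ⟨fun n => qShiftDiffIter q b (stieltjesPoly q n) n, fun n => ?_, fun k => ?_⟩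
  · obtain ⟨hdeg, x, hx⟩ := isSeparated_stieltjesPoly hq0 hq1 n
    obtain ⟨-, y, hy⟩ := isSeparated_qShiftDiffIter hq0 hq1 hb0 hb1 hdeg hx n
    exact hy.isPosRooted
  · simp only [coeff_qShiftDiffIter hq0 hq1 hb0 hb1, coeff_stieltjesPoly hq0 hq1]
    have hpow : Tendsto (fun n : ℕ => q ^ n) atTop (𝓝 0) :=
      tendsto_pow_atTop_nhds_zero_of_lt_one hq0.le hq1
    have h1 : Tendsto (fun n : ℕ => ∏ j ∈ range k, (1 - b * q ^ n * q ^ j) / (1 - b * q ^ j)) atTop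
        (𝓝 (∏ j ∈ range k, (1 - b * 0 * q ^ j) / (1 - b * q ^ j))) :=
      tendsto_finsetProd _ fun j _ =>
        (((hpow.const_mul b).mul_const (q ^ j)).const_sub 1).div_const _
    have h2 : Tendsto (fun n : ℕ => ∏ j ∈ range k, (1 - q ^ n / q ^ j) / (1 - q * q ^ j)) atTop
        (𝓝 (∏ j ∈ range k, (1 - 0 / q ^ j) / (1 - q * q ^ j))) :=
      tendsto_finsetProd _ fun j _ => ((hpow.div_const (q ^ j)).const_sub 1).div_const _
    have h3 := h1.mul (h2.const_mul ((-1) ^ k * q ^ (k * k)))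
    convert h3 using 2
    rw [Finset.prod_div_distrib, Finset.prod_div_distrib]
    simp only [qPochhammer, mul_zero, zero_mul, zero_div, sub_zero, Finset.prod_const_one]
    field_simp

/-! ### The largest reciprocal zero as a limit of ratios of power sums -/

/-- If s is geometric from index 1, multiplying its generating series by 1 - tX leaves a linear
polynomial. The identity is the coefficient of X^(m+1) in (1 - tX) c' = -(s 0 + (s 1 - t s 0) X) c.
-/
theorem IsLogDeriv.two_term {c s : ℕ → ℝ} (h : IsLogDeriv c s) {t : ℝ}
    (ht : ∀ m, s (m + 2) = t * s (m + 1)) (m : ℕ) :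
    ((m : ℝ) + 2) * c (m + 2) - t * ((m + 1) * c (m + 1)) =
      -(s 0 * c (m + 1)) - (s 1 - t * s 0) * c m := by
  have h1 := h (m + 1)
  have h2 := h m
  rw [Finset.Nat.sum_antidiagonal_eq_sum_range_succ_mk,
    ← Finset.sum_range_reflect] at h1 h2
  rw [Finset.sum_range_succ', Finset.sum_range_succ'] at h1
  rw [Finset.sum_range_succ'] at h2
  have hsub1 : ∀ j ∈ range m, c (m + 1 + 1 - 1 - (j + 1 + 1)) *
      s (m + 1 - (m + 1 + 1 - 1 - (j + 1 + 1))) = t * (c (m - (j + 1)) * s (j + 1)) := by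
    intro j hj
    have := Finset.mem_range.1 hj
    rw [show m + 1 + 1 - 1 - (j + 1 + 1) = m - (j + 1) by omega,
      show m + 1 - (m - (j + 1)) = j + 2 by omega, ht]
    ring
  have hsub2 : ∀ j ∈ range m, c (m + 1 - 1 - (j + 1)) * s (m - (m + 1 - 1 - (j + 1))) =
      c (m - (j + 1)) * s (j + 1) := by
    intro j hj
    have := Finset.mem_range.1 hj
    rw [show m + 1 - 1 - (j + 1) = m - (j + 1) by omega,
      show m - (m - (j + 1)) = j + 1 by omega]
  rw [Finset.sum_congr rfl hsub1, ← Finset.mul_sum] at h1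
  rw [Finset.sum_congr rfl hsub2] at h2
  simp only [Nat.succ_eq_add_one, Nat.add_sub_cancel, zero_add, Nat.sub_zero, Nat.sub_self] at h1 h2
  rw [show m + 1 - m = 1 by omega] at h1
  push_cast at h1
  linear_combination h1 - t * h2

/-- The coefficient sequence `c n = (-1)^n b n` alternates, with `(n + 1) b (n + 1) / b n → 0`. -/
structure IsAlternatingRapid (c : ℕ → ℝ) : Prop where
  pos : ∀ n, 0 < (-1) ^ n * c n
  decay : Tendsto (fun n : ℕ => ((n : ℝ) + 1) * (c (n + 1) / c n)) atTop (𝓝 0)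

theorem IsAlternatingRapid.ne_zero {c : ℕ → ℝ} (hc : IsAlternatingRapid c) (n : ℕ) : c n ≠ 0 := by
  have := hc.pos n
  intro h
  simp [h] at this

theorem IsAlternatingRapid.ratio {c : ℕ → ℝ} (hc : IsAlternatingRapid c) :
    Tendsto (fun n : ℕ => c (n + 1) / c n) atTop (𝓝 0) := by
  have h := hc.decay.mul tendsto_one_div_add_atTop_nhds_zero_nat
  rw [mul_zero] at h
  refine h.congr fun n => ?_
  have : (n : ℝ) + 1 ≠ 0 := by positivity
  field_simp

theorem IsAlternatingRapid.ratio_neg {c : ℕ → ℝ} (hc : IsAlternatingRapid c) (n : ℕ) :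
    c (n + 1) / c n < 0 := by
  have h1 := hc.pos n
  have h2 := hc.pos (n + 1)
  have h3 := mul_pos h1 h2
  have h4 : (-1 : ℝ) ^ n * c n * ((-1) ^ (n + 1) * c (n + 1)) = -(c (n + 1) * c n) := by
    have : ((-1 : ℝ) ^ n) * (-1) ^ n = 1 := by rw [← mul_pow]; simp
    rw [pow_succ]
    linear_combination (-(c (n + 1) * c n)) * this
  rw [h4] at h3
  have hne := hc.ne_zero n
  have h5 : c (n + 1) / c n = c (n + 1) * c n / (c n * c n) := by field_simp
  rw [h5]
  exact div_neg_of_neg_of_pos (by linarith) (mul_self_pos.2 hne)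

theorem IsAlternatingRapid.summable {c : ℕ → ℝ} (hc : IsAlternatingRapid c) {R : ℝ} (hR : 0 ≤ R) :
    Summable fun n => |c n| * R ^ n := by
  rcases hR.eq_or_lt with rfl | hR
  · refine summable_of_ne_finset_zero (s := {0}) fun n hn => ?_
    have : n ≠ 0 := by simpa using hn
    simp [this]
  refine summable_of_ratio_test_tendsto_lt_one (l := 0) one_pos
    (Eventually.of_forall fun n => mul_ne_zero (abs_ne_zero.2 (hc.ne_zero n)) (by positivity)) ?_
  have h := hc.ratio.abs.mul_const R
  rw [abs_zero, zero_mul] at h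
  refine h.congr fun n => ?_
  have hne := abs_ne_zero.2 (hc.ne_zero n)
  rw [norm_mul, norm_mul, norm_pow, norm_pow, Real.norm_of_nonneg hR.le, Real.norm_eq_abs,
    Real.norm_eq_abs, abs_abs, abs_abs, abs_div, pow_succ]
  field_simp

/-- The power sums of a rapidly decaying alternating sequence are not eventually geometric. -/
theorem IsAlternatingRapid.not_geometric {c s : ℕ → ℝ} (hc : IsAlternatingRapid c)
    (h : IsLogDeriv c s) (hs0 : 0 < s 0) {t : ℝ} (ht0 : 0 ≤ t) :
    ¬ ∀ m, s (m + 2) = t * s (m + 1) := by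
  intro ht
  have hrec := h.two_term ht
  -- Dividing the recurrence by `c m`, every term on the left tends to 0, so the constant t s 0 - s
  -- 1 is zero.
  have hdiv : ∀ m : ℕ, ((m + 1 : ℕ) + 1 : ℝ) * (c (m + 1 + 1) / c (m + 1)) * (c (m + 1) / c m) -
      t * (((m : ℝ) + 1) * (c (m + 1) / c m)) + s 0 * (c (m + 1) / c m) = t * s 0 - s 1 := by
    intro m
    have h0 := hc.ne_zero m
    have h1 := hc.ne_zero (m + 1)
    have h2 := hrec m
    have : c (m + 1 + 1) / c (m + 1) * (c (m + 1) / c m) = c (m + 2) / c m := by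
      field_simp
    rw [mul_assoc, this]
    push_cast
    field_simp
    linear_combination h2
  have hlim := ((((tendsto_add_atTop_iff_nat 1).2 hc.decay).mul hc.ratio).sub
    (hc.decay.const_mul t)).add (hc.ratio.const_mul (s 0))
  have hC : t * s 0 - s 1 = 0 := by
    refine tendsto_nhds_unique (Tendsto.congr hdiv ?_ : Tendsto (fun _ : ℕ => t * s 0 - s 1) atTop
      (𝓝 0)) ?_ |>.symm ▸ rfl
    all_goals first | exact tendsto_const_nhds | simpa using hlim
  -- The left side is negative and tends to 0. The right side is the nonzero constant -s 0 if t = 0,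
  -- and is eventually positive if t > 0.
  have hdiv2 : ∀ m : ℕ, ((m + 1 : ℕ) + 1 : ℝ) * (c (m + 1 + 1) / c (m + 1)) =
      t * ((m : ℝ) + 1) - s 0 := by
    intro m
    have h0 := hc.ne_zero (m + 1)
    have h2 := hrec m
    push_cast
    field_simp
    linear_combination h2 + c m * hC
  have hlt : ∀ m : ℕ, t * ((m : ℝ) + 1) < s 0 := by
    intro m
    have h1 := hc.ratio_neg (m + 1)
    have h2 := hdiv2 m
    have h3 : ((m + 1 : ℕ) + 1 : ℝ) * (c (m + 1 + 1) / c (m + 1)) < 0 :=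
      mul_neg_of_pos_of_neg (by positivity) h1
    linarith
  rcases ht0.eq_or_lt with rfl | htpos
  · have h1 := (tendsto_add_atTop_iff_nat 1).2 hc.decay
    have h2 : Tendsto (fun _ : ℕ => 0 * ((0 : ℝ) + 1) - s 0) atTop (𝓝 0) :=
      h1.congr fun m => by rw [hdiv2 m]; ring
    have := tendsto_nhds_unique h2 tendsto_const_nhds
    linarith
  · obtain ⟨m, hm⟩ := exists_nat_gt (s 0 / t)
    rw [div_lt_iff₀' htpos] at hm
    nlinarith [hlt m]

/-- If s 1 = 0, submultiplicativity kills all later terms, which is geometric with ratio 0.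
Otherwise log-convexity propagates positivity. -/
theorem IsPowerSumLike.pos {c s : ℕ → ℝ} (hs : IsPowerSumLike s) (hc : IsAlternatingRapid c)
    (h : IsLogDeriv c s) (hs0 : 0 < s 0) (m : ℕ) : 0 < s m := by
  by_cases h1 : s 1 = 0
  · exfalso
    have hz : ∀ m, s (m + 1) = 0 := by
      intro m
      induction m with
      | zero => exact h1
      | succ m ih =>
        have := hs.add_le 0 (m + 1)
        rw [ih, mul_zero, zero_add] at this
        exact le_antisymm this (hs.nonneg _)
    exact hc.not_geometric h hs0 le_rfl fun m => by rw [hz, zero_mul]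
  · have h1 : 0 < s 1 := lt_of_le_of_ne (hs.nonneg 1) (Ne.symm h1)
    have key : ∀ m, 0 < s m ∧ 0 < s (m + 1) := by
      intro m
      induction m with
      | zero => exact ⟨hs0, h1⟩
      | succ m ih =>
        refine ⟨ih.2, lt_of_le_of_ne (hs.nonneg _) fun h0 => ?_⟩
        have := hs.sq_le m
        rw [← h0, mul_zero] at this
        exact absurd this (not_le.2 (pow_pos ih.2 2))
    exact (key m).1

/-- The data of an entire function with coefficients `c`, power sums `s` of its reciprocal zeros,
and largest reciprocal zero `t`. -/
structure HasTopReciprocalZero (c s : ℕ → ℝ) (t : ℝ) : Prop where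
  rapid : IsAlternatingRapid c
  zero : c 0 = 1
  logDeriv : IsLogDeriv c s
  pos : 0 < t
  pow_le : ∀ m, t ^ (m + 1) ≤ s m
  le_pow : ∀ m, s m ≤ s 0 * t ^ m
  succ_lt : ∀ m ≤ 1, s (m + 1) < t * s m

/-- Log-convexity makes s (m+1) / s m increase, and s 0 bounds it; t is its limit. Then s (k+m+1) /
s k tends to t^(m+1) as k grows, and it is at most s m by submultiplicativity. -/
theorem IsPosRootedLimit.exists_hasTopReciprocalZero {c : ℕ → ℝ} (hlim : IsPosRootedLimit c)
    (hc : IsAlternatingRapid c) : ∃ s t, HasTopReciprocalZero c s t := by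
  obtain ⟨h0, s, hlog, hs⟩ := hlim.exists_powerSum
  have hs0 : 0 < s 0 := by
    have h1 := hlog 0
    have h2 := hc.pos 1
    simp [h0] at h1 h2
    linarith
  have hpos := hs.pos hc hlog hs0
  have hmono : Monotone fun m => s (m + 1) / s m := by
    refine monotone_nat_of_le_succ fun m => ?_
    rw [div_le_div_iff₀ (hpos _) (hpos _)]
    have := hs.sq_le m
    nlinarith
  have hbdd : BddAbove (Set.range fun m => s (m + 1) / s m) := by
    refine ⟨s 0, ?_⟩
    rintro _ ⟨m, rfl⟩
    have := hs.add_le 0 m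
    rw [zero_add] at this
    exact (div_le_iff₀ (hpos m)).2 this
  obtain ⟨t, ht⟩ : ∃ t, t = ⨆ m, s (m + 1) / s m := ⟨_, rfl⟩
  have htend : Tendsto (fun m => s (m + 1) / s m) atTop (𝓝 t) := by
    rw [ht]; exact tendsto_atTop_ciSup hmono hbdd
  have hle : ∀ m, s (m + 1) ≤ t * s m := by
    intro m
    rw [← div_le_iff₀ (hpos m), ht]
    exact le_ciSup hbdd m
  have htpos : 0 < t := by
    have := hle 0
    have h1 := hpos 1
    by_contra hcon
    nlinarith
  have hpowtend : ∀ j, Tendsto (fun k => s (k + j) / s k) atTop (𝓝 (t ^ j)) := by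
    intro j
    induction j with
    | zero =>
      simp only [add_zero, pow_zero]
      exact tendsto_const_nhds.congr fun k => (div_self (hpos k).ne').symm
    | succ j ih =>
      have h1 := ((tendsto_add_atTop_iff_nat j).2 htend).mul ih
      rw [pow_succ']
      refine h1.congr fun k => ?_
      have := (hpos (k + j)).ne'
      have := (hpos k).ne'
      rw [← add_assoc]
      field_simp
  have hpowle : ∀ m, t ^ (m + 1) ≤ s m := by
    intro m
    refine le_of_tendsto' (hpowtend (m + 1)) fun k => ?_
    rw [div_le_iff₀ (hpos k), mul_comm, ← add_assoc]
    exact hs.add_le k m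
  refine ⟨s, t, hc, h0, hlog, htpos, hpowle, fun m => ?_, fun m hm => ?_⟩
  · induction m with
    | zero => simp
    | succ m ih =>
      calc s (m + 1) ≤ t * s m := hle m
        _ ≤ t * (s 0 * t ^ m) := mul_le_mul_of_nonneg_left ih htpos.le
        _ = s 0 * t ^ (m + 1) := by ring
  -- Equality at m propagates upwards by log-convexity. The restriction m ≤ 1 makes the geometric
  -- range include every index from 1 on, as `not_geometric` requires.
  · refine lt_of_le_of_ne (hle m) fun heq => ?_
    have hall : ∀ k, s (m + k + 1) = t * s (m + k) := by
      intro k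
      induction k with
      | zero => exact heq
      | succ k ih =>
        refine le_antisymm (hle _) ?_
        have h1 := hs.sq_le (m + k)
        have h2 := hpos (m + k)
        rw [← add_assoc, ih]
        rw [ih] at h1
        have h3 : s (m + k) * (t * (t * s (m + k))) ≤ s (m + k) * s (m + k + 2) := by
          nlinarith
        exact le_of_mul_le_mul_left h3 h2
    refine hc.not_geometric hlog hs0 htpos.le fun k => ?_
    have := hall (k + 1 - m)
    rwa [show m + (k + 1 - m) = k + 1 by omega] at this

/-- The lower Euler–Rayleigh bound: t² ≤ s 1 < t s 0. -/
theorem HasTopReciprocalZero.lt_zero {c s : ℕ → ℝ} {t : ℝ} (h : HasTopReciprocalZero c s t) :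
    t < s 0 := by
  have h1 := h.pow_le 1
  have h2 := h.succ_lt 0 (by norm_num)
  have h3 := h.pos
  norm_num at h1 h2
  nlinarith

theorem HasTopReciprocalZero.sq_lt_one {c s : ℕ → ℝ} {t : ℝ} (h : HasTopReciprocalZero c s t) :
    t ^ 2 < s 1 := by
  have h1 := h.pow_le 2
  have h2 := h.succ_lt 1 le_rfl
  have h3 := h.pos
  norm_num at h1 h2
  nlinarith

/-! ### Power series: the first zero lies exactly at 1/t -/

/-- The complex power series with real coefficients `c`. -/
noncomputable def realPowerSeries (c : ℕ → ℝ) (z : ℂ) : ℂ := ∑' n, (c n : ℂ) * z ^ n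

theorem summable_norm_realPowerSeries {c : ℕ → ℝ} {z : ℂ} (h : Summable fun n => |c n| * ‖z‖ ^ n) :
    Summable fun n => ‖(c n : ℂ) * z ^ n‖ := by
  simpa using h

theorem realPowerSeries_ofReal (c : ℕ → ℝ) (r : ℝ) :
    realPowerSeries c r = ((∑' n, c n * r ^ n : ℝ) : ℂ) := by
  rw [realPowerSeries, Complex.ofReal_tsum]
  simp

theorem realPowerSeries_zero (c : ℕ → ℝ) : realPowerSeries c 0 = c 0 := by
  rw [realPowerSeries, tsum_eq_single 0 (fun n hn => by simp [hn])]
  simp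

theorem hasDerivAt_realPowerSeries {c : ℕ → ℝ}
    (hc : ∀ R : ℝ, 0 ≤ R → Summable fun n => |c n| * R ^ n) (z : ℂ) :
    HasDerivAt (realPowerSeries c) (realPowerSeries (fun n => ((n : ℝ) + 1) * c (n + 1)) z) z := by
  -- The factor 2 absorbs the n from differentiation, as n ≤ 2^n.
  have hR : 0 ≤ 2 * (‖z‖ + 1) := by positivity
  have h1 : ∀ w ∈ Metric.ball (0 : ℂ) (‖z‖ + 1),
      HasDerivAt (fun w => ∑' n, (c n : ℂ) * w ^ n) (∑' n : ℕ, (c n : ℂ) * (n * w ^ (n - 1))) w := by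
    intro w hw
    refine hasDerivAt_tsum_of_isPreconnected (hc _ hR) Metric.isOpen_ball
      (convex_ball (0 : ℂ) (‖z‖ + 1)).isPreconnected
      (fun n y _ => (hasDerivAt_pow n y).const_mul _) (fun n y hy => ?_)
      (Metric.mem_ball_self (by positivity)) ?_ hw
    · rw [mem_ball_zero_iff] at hy
      rw [norm_mul, norm_mul, norm_pow, Complex.norm_real, Real.norm_eq_abs, Complex.norm_natCast]
      refine mul_le_mul_of_nonneg_left ?_ (abs_nonneg _)
      rw [mul_pow]
      refine mul_le_mul (by exact_mod_cast Nat.lt_two_pow_self.le) ?_ (by positivity)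
        (by positivity)
      calc ‖y‖ ^ (n - 1) ≤ (‖z‖ + 1) ^ (n - 1) := by gcongr
        _ ≤ (‖z‖ + 1) ^ n := pow_le_pow_right₀ (by linarith [norm_nonneg z]) (Nat.sub_le _ _)
    · refine summable_of_ne_finset_zero (s := {0}) fun n hn => ?_
      have : n ≠ 0 := by simpa using hn
      simp [this]
  have h2 := h1 z (by simp)
  refine h2.congr_deriv ?_
  have hsum : Summable fun n : ℕ => (c n : ℂ) * (n * z ^ (n - 1)) := by
    refine Summable.of_norm_bounded (hc _ hR) fun n => ?_
    rw [norm_mul, norm_mul, norm_pow, Complex.norm_real, Real.norm_eq_abs, Complex.norm_natCast]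
    refine mul_le_mul_of_nonneg_left ?_ (abs_nonneg _)
    rw [mul_pow]
    refine mul_le_mul (by exact_mod_cast Nat.lt_two_pow_self.le) ?_ (by positivity) (by positivity)
    calc ‖z‖ ^ (n - 1) ≤ (‖z‖ + 1) ^ (n - 1) := by gcongr; linarith
      _ ≤ (‖z‖ + 1) ^ n := pow_le_pow_right₀ (by linarith [norm_nonneg z]) (Nat.sub_le _ _)
  rw [hsum.tsum_eq_zero_add, realPowerSeries]
  simp only [Nat.cast_zero, zero_mul, mul_zero, zero_add]
  refine tsum_congr fun n => ?_
  push_cast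
  ring

theorem IsLogDeriv.realPowerSeries_eq {c s : ℕ → ℝ} (h : IsLogDeriv c s) {z : ℂ}
    (hc : Summable fun n => |c n| * ‖z‖ ^ n) (hs : Summable fun n => |s n| * ‖z‖ ^ n) :
    realPowerSeries (fun n => ((n : ℝ) + 1) * c (n + 1)) z =
      -(realPowerSeries c z * realPowerSeries s z) := by
  rw [realPowerSeries, realPowerSeries, realPowerSeries,
    tsum_mul_tsum_eq_tsum_sum_antidiagonal_of_summable_norm (summable_norm_realPowerSeries hc)
      (summable_norm_realPowerSeries hs), ← tsum_neg]
  refine tsum_congr fun m => ?_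
  simp only [h m]
  push_cast
  rw [neg_mul, Finset.sum_mul]
  congr 1
  refine Finset.sum_congr rfl fun p hp => ?_
  rw [← Finset.HasAntidiagonal.mem_antidiagonal.1 hp, pow_add]
  ring

namespace HasTopReciprocalZero

variable {c s : ℕ → ℝ} {t : ℝ}

theorem nonneg (h : HasTopReciprocalZero c s t) (m : ℕ) : 0 ≤ s m :=
  (pow_pos h.pos _).le.trans (h.pow_le m)

theorem summable_powerSum (h : HasTopReciprocalZero c s t) {r : ℝ} (hr0 : 0 ≤ r)
    (hr : r < t⁻¹) : Summable fun n => s n * r ^ n := by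
  have hlt : t * r < 1 := by
    have := mul_lt_mul_of_pos_left hr h.pos
    rwa [mul_inv_cancel₀ h.pos.ne'] at this
  refine Summable.of_nonneg_of_le (fun n => mul_nonneg (h.nonneg n) (pow_nonneg hr0 n))
    (fun n => ?_) ((summable_geometric_of_lt_one (mul_nonneg h.pos.le hr0) hlt).mul_left (s 0))
  rw [mul_pow, ← mul_assoc]
  exact mul_le_mul_of_nonneg_right (h.le_pow n) (pow_nonneg hr0 n)

theorem summable_abs_powerSum (h : HasTopReciprocalZero c s t) {r : ℝ} (hr0 : 0 ≤ r)
    (hr : r < t⁻¹) : Summable fun n => |s n| * r ^ n := by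
  simpa only [abs_of_nonneg (h.nonneg _)] using h.summable_powerSum hr0 hr

theorem hasDerivAt (h : HasTopReciprocalZero c s t) (z : ℂ) :
    HasDerivAt (realPowerSeries c) (realPowerSeries (fun n => ((n : ℝ) + 1) * c (n + 1)) z) z :=
  hasDerivAt_realPowerSeries (fun _ hR => h.rapid.summable hR) z

theorem deriv_eq (h : HasTopReciprocalZero c s t) {z : ℂ} (hz : ‖z‖ < t⁻¹) :
    realPowerSeries (fun n => ((n : ℝ) + 1) * c (n + 1)) z =
      -(realPowerSeries c z * realPowerSeries s z) :=
  h.logDeriv.realPowerSeries_eq (h.rapid.summable (norm_nonneg z))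
    (h.summable_abs_powerSum (norm_nonneg z) hz)

theorem norm_powerSum_le (h : HasTopReciprocalZero c s t) {z : ℂ} {r : ℝ} (hz : ‖z‖ ≤ r)
    (hr : r < t⁻¹) : ‖realPowerSeries s z‖ ≤ ∑' n, s n * r ^ n := by
  have hr0 := (norm_nonneg z).trans hz
  refine tsum_of_norm_bounded (h.summable_powerSum hr0 hr).hasSum fun n => ?_
  rw [norm_mul, norm_pow, Complex.norm_real, Real.norm_of_nonneg (h.nonneg n)]
  exact mul_le_mul_of_nonneg_left (pow_le_pow_left₀ (norm_nonneg z) hz n) (h.nonneg n)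

theorem apply_zero (h : HasTopReciprocalZero c s t) : realPowerSeries c 0 = 1 := by
  rw [realPowerSeries_zero, h.zero, Complex.ofReal_one]

/-- A zero at z would spread along the segment from z to 0 by Grönwall's inequality for f' = -f S
with S bounded, contradicting f(0) = 1. -/
theorem ne_zero (h : HasTopReciprocalZero c s t) {z : ℂ} (hz : ‖z‖ < t⁻¹) :
    realPowerSeries c z ≠ 0 := by
  intro hzero
  set g : ℝ → ℂ := fun τ => realPowerSeries c ((1 - τ : ℝ) * z) with hg
  set D : ℂ → ℂ := realPowerSeries (fun n => ((n : ℝ) + 1) * c (n + 1))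
  have hderiv : ∀ τ : ℝ, HasDerivAt g (D ((1 - τ : ℝ) * z) * (-1 * z)) τ := by
    intro τ
    have h1 : HasDerivAt (fun τ : ℝ => ((1 - τ : ℝ) : ℂ) * z) (-1 * z) τ := by
      have : HasDerivAt (fun τ : ℝ => ((1 - τ : ℝ) : ℂ)) (-1) τ := by
        simpa using ((hasDerivAt_id τ).const_sub 1).ofReal_comp
      exact this.mul_const z
    exact (h.hasDerivAt _).comp τ h1
  have hball : ∀ τ ∈ Set.Ico (0 : ℝ) 1, ‖((1 - τ : ℝ) : ℂ) * z‖ ≤ ‖z‖ := by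
    intro τ hτ
    rw [norm_mul, Complex.norm_real, Real.norm_of_nonneg (by linarith [hτ.2])]
    nlinarith [norm_nonneg z, hτ.1]
  have h0 := eq_zero_of_abs_deriv_le_mul_abs_self_of_eq_zero_right (f := g)
    (K := ‖z‖ * ∑' n, s n * ‖z‖ ^ n) (a := 0) (b := 1)
    (fun τ _ => (hderiv τ).continuousAt.continuousWithinAt)
    (fun τ _ => (hderiv τ).hasDerivWithinAt) (by simpa [hg] using hzero) (fun τ hτ => ?_) 1
    (by simp)
  · simp [hg, h.apply_zero] at h0
  · have h1 := hball τ hτ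
    have h2 := h.norm_powerSum_le h1 hz
    simp only [D]
    rw [h.deriv_eq (h1.trans_lt hz), norm_mul, norm_neg, norm_mul, norm_mul, norm_neg, norm_one,
      one_mul]
    calc _ ≤ ‖g τ‖ * (∑' n, s n * ‖z‖ ^ n) * ‖z‖ := by gcongr
      _ = _ := by ring

theorem continuous_re (h : HasTopReciprocalZero c s t) :
    Continuous fun r : ℝ => (realPowerSeries c r).re := by
  have : Continuous (realPowerSeries c) :=
    continuous_iff_continuousAt.2 fun z => (h.hasDerivAt z).continuousAt
  exact Complex.continuous_re.comp (this.comp Complex.continuous_ofReal)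

theorem exists_root (h : HasTopReciprocalZero c s t) {r : ℝ} (hr : 0 ≤ r)
    (hneg : (realPowerSeries c r).re ≤ 0) : t⁻¹ ≤ r := by
  obtain ⟨x, hx, hx0⟩ := intermediate_value_Icc' hr h.continuous_re.continuousOn
    ⟨hneg, by simp [h.apply_zero]⟩
  by_contra hcon
  refine h.ne_zero (z := x) ?_ ?_
  · rw [Complex.norm_real, Real.norm_of_nonneg hx.1]
    exact hx.2.trans_lt (not_le.1 hcon)
  · simp only [realPowerSeries_ofReal, Complex.ofReal_re] at hx0 ⊢
    rw [hx0, Complex.ofReal_zero]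

theorem re_pos (h : HasTopReciprocalZero c s t) {r : ℝ} (hr0 : 0 ≤ r) (hr : r < t⁻¹) :
    0 < (realPowerSeries c r).re := by
  by_contra hcon
  exact absurd (h.exists_root hr0 (not_lt.1 hcon)) (not_le.2 hr)

theorem le_tsum_powerSum (h : HasTopReciprocalZero c s t) {r : ℝ} (hr0 : 0 ≤ r) (hr : r < t⁻¹) :
    t / (1 - t * r) ≤ ∑' n, s n * r ^ n := by
  have hlt : t * r < 1 := by
    have := mul_lt_mul_of_pos_left hr h.pos
    rwa [mul_inv_cancel₀ h.pos.ne'] at this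
  have hgeo := (hasSum_geometric_of_lt_one (mul_nonneg h.pos.le hr0) hlt).mul_left t
  refine hasSum_le (fun n => ?_) hgeo (h.summable_powerSum hr0 hr).hasSum
  rw [mul_pow, ← mul_assoc, ← pow_succ']
  exact mul_le_mul_of_nonneg_right (h.pow_le n) (pow_nonneg hr0 n)

/-- Since S(r) ≥ t/(1 - t r), one has |f(r)| t ≤ |f'(r)| (1 - t r) for 0 < r < 1/t. The right side
tends to 0 as r increases to 1/t. -/
theorem eq_zero (h : HasTopReciprocalZero c s t) : realPowerSeries c (t⁻¹ : ℝ) = 0 := by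
  set D : ℂ → ℂ := realPowerSeries (fun n => ((n : ℝ) + 1) * c (n + 1)) with hD
  have hcontf : Continuous (realPowerSeries c) :=
    continuous_iff_continuousAt.2 fun z => (h.hasDerivAt z).continuousAt
  have htinv : 0 < t⁻¹ := inv_pos.2 h.pos
  have hcontD : Continuous D := by
    have hdiff : Differentiable ℂ (realPowerSeries c) := fun z => (h.hasDerivAt z).differentiableAt
    have : deriv (realPowerSeries c) = D := funext fun z => (h.hasDerivAt z).deriv
    rw [← this]
    exact (hdiff.contDiff (n := 1)).continuous_deriv le_rfl
  have hbound : ∀ r ∈ Set.Ioo (0 : ℝ) t⁻¹,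
      ‖realPowerSeries c r‖ * t ≤ ‖D r‖ * (1 - t * r) := by
    intro r hr
    have hn : ‖(r : ℂ)‖ < t⁻¹ := by
      rw [Complex.norm_real, Real.norm_of_nonneg hr.1.le]; exact hr.2
    have hlt : t * r < 1 := by
      have := mul_lt_mul_of_pos_left hr.2 h.pos
      rwa [mul_inv_cancel₀ h.pos.ne'] at this
    have h1 := h.le_tsum_powerSum hr.1.le hr.2
    rw [div_le_iff₀ (by linarith)] at h1
    have h2 : ‖D r‖ = ‖realPowerSeries c r‖ * ∑' n, s n * r ^ n := by
      rw [hD, h.deriv_eq hn, norm_neg, norm_mul, realPowerSeries_ofReal s, Complex.norm_real,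
        Real.norm_of_nonneg]
      exact tsum_nonneg fun n => mul_nonneg (h.nonneg n) (pow_nonneg hr.1.le n)
    rw [h2, mul_assoc]
    exact mul_le_mul_of_nonneg_left h1 (norm_nonneg _)
  have hlim1 : Tendsto (fun r : ℝ => ‖realPowerSeries c r‖ * t) (𝓝[<] t⁻¹)
      (𝓝 (‖realPowerSeries c (t⁻¹ : ℝ)‖ * t)) :=
    (((hcontf.comp Complex.continuous_ofReal).norm.mul_const t).tendsto _).mono_left
      nhdsWithin_le_nhds
  have hlim2 : Tendsto (fun r : ℝ => ‖D r‖ * (1 - t * r)) (𝓝[<] t⁻¹)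
      (𝓝 (‖D (t⁻¹ : ℝ)‖ * (1 - t * t⁻¹))) :=
    (((hcontD.comp Complex.continuous_ofReal).norm.mul (by fun_prop)).tendsto _).mono_left
      nhdsWithin_le_nhds
  have hle := le_of_tendsto_of_tendsto hlim1 hlim2
    (eventually_of_mem (Ioo_mem_nhdsLT htinv) hbound)
  rw [mul_inv_cancel₀ h.pos.ne', sub_self, mul_zero] at hle
  have := norm_nonneg (realPowerSeries c (t⁻¹ : ℝ))
  exact norm_eq_zero.1 (le_antisymm (by nlinarith [h.pos]) this)

end HasTopReciprocalZero

/-- The derivative of `z f(z)` in terms of coefficients. -/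
theorem realPowerSeries_succ_mul {c : ℕ → ℝ}
    (hc : ∀ R : ℝ, 0 ≤ R → Summable fun n => |c n| * R ^ n)
    (hd : ∀ R : ℝ, 0 ≤ R → Summable fun n : ℕ => |((n : ℝ) + 1) * c n| * R ^ n) (z : ℂ) :
    realPowerSeries (fun n => ((n : ℝ) + 1) * c n) z = realPowerSeries c z +
      z * realPowerSeries (fun n => ((n : ℝ) + 1) * c (n + 1)) z := by
  have h1 := (summable_norm_realPowerSeries (hc _ (norm_nonneg z))).of_norm
  have h2 := (summable_norm_realPowerSeries (hd _ (norm_nonneg z))).of_norm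
  have h3 : realPowerSeries (fun n => ((n : ℝ) + 1) * c n) z - realPowerSeries c z =
      ∑' n : ℕ, (n : ℂ) * c n * z ^ n := by
    rw [realPowerSeries, realPowerSeries, ← h2.tsum_sub h1]
    refine tsum_congr fun n => ?_
    push_cast
    ring
  have h4 : Summable fun n : ℕ => (n : ℂ) * c n * z ^ n := by
    refine (h2.sub h1).congr fun n => ?_
    push_cast
    ring
  rw [h4.tsum_eq_zero_add] at h3
  rw [← sub_eq_iff_eq_add', h3, realPowerSeries, ← tsum_mul_left]
  simp only [Nat.cast_zero, zero_mul, zero_add]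
  refine tsum_congr fun n => ?_
  push_cast
  ring

/-! ### Starlikeness of z f up to the first zero of its derivative -/

section Starlike

variable {c s d σ : ℕ → ℝ} {u t : ℝ}

theorem HasTopReciprocalZero.succ_mul_eq (hf : HasTopReciprocalZero c s u)
    (hg : HasTopReciprocalZero (fun n => ((n : ℝ) + 1) * c n) σ t) {z : ℂ} (hz : ‖z‖ < u⁻¹) :
    realPowerSeries (fun n => ((n : ℝ) + 1) * c n) z =
      realPowerSeries c z * (1 - z * realPowerSeries s z) := by
  rw [realPowerSeries_succ_mul (fun _ hR => hf.rapid.summable hR)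
    (fun _ hR => hg.rapid.summable hR), hf.deriv_eq hz]
  ring

/-- Here (z f)' = f(r) (1 - r S(r)) ≤ 0 at r because f(r) > 0, so (z f)' already vanishes somewhere
up to r. -/
theorem HasTopReciprocalZero.inv_le_of_one_le (hf : HasTopReciprocalZero c s u)
    (hg : HasTopReciprocalZero (fun n => ((n : ℝ) + 1) * c n) σ t) {r : ℝ} (hr0 : 0 ≤ r)
    (hr : r < u⁻¹) (hone : 1 ≤ r * ∑' n, s n * r ^ n) : t⁻¹ ≤ r := by
  refine hg.exists_root hr0 ?_
  have hn : ‖(r : ℂ)‖ < u⁻¹ := by rwa [Complex.norm_real, Real.norm_of_nonneg hr0]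
  rw [hf.succ_mul_eq hg hn]
  have hpos := hf.re_pos hr0 hr
  rw [realPowerSeries_ofReal] at hpos ⊢
  rw [realPowerSeries_ofReal s]
  norm_cast
  rw [Complex.ofReal_re] at hpos
  nlinarith

/-- At r = 1/(2u) the bound S(r) ≥ u/(1 - u r) = 2u already gives r S(r) ≥ 1. -/
theorem HasTopReciprocalZero.inv_lt_inv (hf : HasTopReciprocalZero c s u)
    (hg : HasTopReciprocalZero (fun n => ((n : ℝ) + 1) * c n) σ t) : t⁻¹ < u⁻¹ := by
  have hu := inv_pos.2 hf.pos
  have hlt : u⁻¹ / 2 < u⁻¹ := by linarith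
  refine lt_of_le_of_lt (hf.inv_le_of_one_le hg (by positivity) hlt ?_) hlt
  have h1 := hf.le_tsum_powerSum (r := u⁻¹ / 2) (by positivity) hlt
  have h2 : u * (u⁻¹ / 2) = 1 / 2 := by have := hf.pos.ne'; field_simp
  rw [h2] at h1
  calc (1 : ℝ) = u⁻¹ / 2 * (u / (1 - 1 / 2)) := by have := hf.pos.ne'; field_simp; norm_num
    _ ≤ _ := mul_le_mul_of_nonneg_left h1 (by positivity)

/-- On the disk bounded by the first zero of `(z f)'`, the function `z f` is starlike. -/
theorem HasTopReciprocalZero.re_div_pos (hf : HasTopReciprocalZero c s u)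
    (hg : HasTopReciprocalZero (fun n => ((n : ℝ) + 1) * c n) σ t) {z : ℂ} (hz : ‖z‖ < t⁻¹) :
    0 < (realPowerSeries (fun n => ((n : ℝ) + 1) * c n) z / realPowerSeries c z).re := by
  have hzu := hz.trans (hf.inv_lt_inv hg)
  rw [hf.succ_mul_eq hg hzu, mul_div_cancel_left₀ _ (hf.ne_zero hzu)]
  -- The coefficients of S being nonnegative, the positive ray is the worst direction, so it
  -- suffices to bound |z| S(|z|).
  have h1 : ‖z‖ * ∑' n, s n * ‖z‖ ^ n < 1 := by
    by_contra hcon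
    exact absurd (hf.inv_le_of_one_le hg (norm_nonneg z) hzu (not_lt.1 hcon)) (not_le.2 hz)
  have h2 : (z * realPowerSeries s z).re ≤ ‖z‖ * ∑' n, s n * ‖z‖ ^ n := by
    refine (Complex.re_le_norm _).trans ?_
    rw [norm_mul]
    exact mul_le_mul_of_nonneg_left (hf.norm_powerSum_le le_rfl hzu) (norm_nonneg z)
  rw [Complex.sub_re, Complex.one_re]
  linarith

end Starlike

/-! ### The Jackson function as a power series; the root equation -/

theorem one_sub_mul_pow_pos {q a : ℝ} (hq0 : 0 < q) (hq1 : q < 1) (ha0 : 0 ≤ a) (ha1 : a < 1)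
    (n : ℕ) : 0 < 1 - a * q ^ n := by
  have : q ^ n ≤ 1 := pow_le_one₀ hq0.le hq1.le
  nlinarith

theorem qPochhammer_pos {q a : ℝ} (hq0 : 0 < q) (hq1 : q < 1) (ha0 : 0 ≤ a) (ha1 : a < 1)
    (n : ℕ) : 0 < qPochhammer a q n :=
  Finset.prod_pos fun k _ => one_sub_mul_pow_pos hq0 hq1 ha0 ha1 k

theorem qPochhammerInf_ne_zero {q a : ℝ} (hq0 : 0 < q) (hq1 : q < 1) (ha0 : 0 ≤ a) (ha1 : a < 1) :
    qPochhammerInf a q ≠ 0 := by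
  have h := tprod_one_add_ne_zero_of_summable (f := fun n : ℕ => -(a * q ^ n)) (fun n => ?_) ?_
  · simpa only [qPochhammerInf, sub_eq_add_neg] using h
  · have := one_sub_mul_pow_pos hq0 hq1 ha0 ha1 n
    rw [← sub_eq_add_neg]
    exact this.ne'
  · refine ((summable_geometric_of_lt_one hq0.le hq1).mul_left a).congr fun n => ?_
    rw [norm_neg, Real.norm_of_nonneg (by positivity)]

theorem IsAlternatingRapid.succ_mul {c : ℕ → ℝ} (hc : IsAlternatingRapid c) :
    IsAlternatingRapid fun n => ((n : ℝ) + 1) * c n where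
  pos n := by
    rw [mul_left_comm]
    exact mul_pos (by positivity) (hc.pos n)
  decay := by
    have h := hc.decay.add hc.ratio
    rw [add_zero] at h
    refine h.congr fun n => ?_
    have := hc.ne_zero n
    have : (n : ℝ) + 1 ≠ 0 := by positivity
    push_cast
    field_simp

/-- The coefficients of the entire function `z ↦ h_ν^{(2)}(z;q) / z`. -/
noncomputable def jacksonCoeff (ν q : ℝ) (n : ℕ) : ℝ :=
  (-1) ^ n * q ^ (n * n) / (qPochhammer q q n * qPochhammer (q ^ (ν + 1)) q n) * (q ^ ν / 4) ^ n

section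

variable {ν q : ℝ}

theorem rpow_add_one_lt_one (hν : -1 < ν) (hq0 : 0 < q) (hq1 : q < 1) : q ^ (ν + 1) < 1 :=
  Real.rpow_lt_one hq0.le hq1 (by linarith)

theorem isPosRootedLimit_jacksonCoeff (hν : -1 < ν) (hq0 : 0 < q) (hq1 : q < 1) :
    IsPosRootedLimit (jacksonCoeff ν q) :=
  (isPosRootedLimit_qBessel hq0 hq1 (Real.rpow_pos_of_pos hq0 _).le
    (rpow_add_one_lt_one hν hq0 hq1)).mul_pow (by have := Real.rpow_pos_of_pos hq0 ν; positivity)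

theorem jacksonCoeff_zero : jacksonCoeff ν q 0 = 1 := by simp [jacksonCoeff, qPochhammer]

theorem jacksonCoeff_succ (hν : -1 < ν) (hq0 : 0 < q) (hq1 : q < 1) (n : ℕ) :
    jacksonCoeff ν q (n + 1) = -(q ^ n * q ^ n * q ^ (ν + 1) /
      (4 * ((1 - q * q ^ n) * (1 - q ^ (ν + 1) * q ^ n)))) * jacksonCoeff ν q n := by
  have hb0 := (Real.rpow_pos_of_pos hq0 (ν + 1)).le
  have hb1 := rpow_add_one_lt_one hν hq0 hq1
  have h1 := (qPochhammer_pos hq0 hq1 hq0.le hq1 n).ne'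
  have h2 := (qPochhammer_pos hq0 hq1 hb0 hb1 n).ne'
  have h3 := (one_sub_mul_pow_pos hq0 hq1 hq0.le hq1 n).ne'
  have h4 := (one_sub_mul_pow_pos hq0 hq1 hb0 hb1 n).ne'
  have e1 : ∀ a, qPochhammer a q (n + 1) = qPochhammer a q n * (1 - a * q ^ n) := fun a =>
    Finset.prod_range_succ _ _
  have e2 : q ^ ((n + 1) * (n + 1)) = q ^ (n * n) * (q ^ n) ^ 2 * q := by ring
  simp only [jacksonCoeff, e1, e2]
  have e3 : q ^ (ν + 1) = q ^ ν * q := by rw [Real.rpow_add hq0, Real.rpow_one]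
  rw [pow_succ (-1 : ℝ), pow_succ (q ^ ν / 4)]
  generalize qPochhammer q q n = A at *
  generalize qPochhammer (q ^ (ν + 1)) q n = B at *
  generalize 1 - q * q ^ n = U at *
  generalize 1 - q ^ (ν + 1) * q ^ n = V at *
  rw [e3]
  field_simp

theorem isAlternatingRapid_jacksonCoeff (hν : -1 < ν) (hq0 : 0 < q) (hq1 : q < 1) :
    IsAlternatingRapid (jacksonCoeff ν q) := by
  have hb0 := Real.rpow_pos_of_pos hq0 (ν + 1)
  have hb1 := rpow_add_one_lt_one hν hq0 hq1
  have hpos : ∀ n, 0 < (-1) ^ n * jacksonCoeff ν q n := by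
    intro n
    induction n with
    | zero => simp [jacksonCoeff_zero]
    | succ n ih =>
      rw [jacksonCoeff_succ hν hq0 hq1]
      have h3 := one_sub_mul_pow_pos hq0 hq1 hq0.le hq1 n
      have h4 := one_sub_mul_pow_pos hq0 hq1 hb0.le hb1 n
      have : 0 < q ^ n * q ^ n * q ^ (ν + 1) /
        (4 * ((1 - q * q ^ n) * (1 - q ^ (ν + 1) * q ^ n))) := by positivity
      calc 0 < _ := mul_pos this ih
        _ = _ := by rw [pow_succ]; ring
  refine ⟨hpos, ?_⟩
  have hne : ∀ n, jacksonCoeff ν q n ≠ 0 := by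
    intro n h
    have := hpos n
    simp [h] at this
  have hpow : Tendsto (fun n : ℕ => q ^ n) atTop (𝓝 0) :=
    tendsto_pow_atTop_nhds_zero_of_lt_one hq0.le hq1
  have h1 : Tendsto (fun n : ℕ => ((n : ℝ) + 1) * q ^ n) atTop (𝓝 0) := by
    have := (tendsto_self_mul_const_pow_of_lt_one hq0.le hq1).add hpow
    rw [add_zero] at this
    exact this.congr fun n => by ring
  have h2 : Tendsto (fun n : ℕ => -(q ^ n * q ^ (ν + 1) /
      (4 * ((1 - q * q ^ n) * (1 - q ^ (ν + 1) * q ^ n))))) atTop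
      (𝓝 (-(0 * q ^ (ν + 1) / (4 * ((1 - q * 0) * (1 - q ^ (ν + 1) * 0)))))) := by
    refine ((hpow.mul_const _).div ((((hpow.const_mul q).const_sub 1).mul
      ((hpow.const_mul _).const_sub 1)).const_mul 4) (by simp)).neg
  have h3 := h1.mul h2
  rw [zero_mul] at h3
  refine h3.congr fun n => ?_
  rw [jacksonCoeff_succ hν hq0 hq1, mul_div_cancel_right₀ _ (hne n)]
  ring

theorem jacksonBessel_eq (hq0 : 0 < q) {z : ℂ} (hz : z ≠ 0) :
    jacksonBessel ν q z = ((qPochhammerInf (q ^ (ν + 1)) q / qPochhammerInf q q : ℝ) : ℂ) *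
      ((z / 2) ^ (ν : ℂ) * realPowerSeries (jacksonCoeff ν q) (z ^ 2)) := by
  rw [jacksonBessel, realPowerSeries]
  congr 1
  rw [← tsum_mul_left (a := (z / 2) ^ (ν : ℂ))]
  refine tsum_congr fun n => ?_
  have hz2 : z / 2 ≠ 0 := div_ne_zero hz two_ne_zero
  have h1 : (z / 2) ^ (2 * (n : ℂ) + (ν : ℂ)) = (z ^ 2) ^ n * (1 / 4) ^ n * (z / 2) ^ (ν : ℂ) := by
    rw [Complex.cpow_add _ _ hz2]
    congr 1
    have : (2 * (n : ℂ)) = ((2 * n : ℕ) : ℂ) := by push_cast; ring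
    rw [this, Complex.cpow_natCast, pow_mul, ← mul_pow]
    congr 1
    ring
  have h2 : q ^ ((n : ℝ) * ((n : ℝ) + ν)) = q ^ (n * n) * (q ^ ν) ^ n := by
    rw [mul_add, Real.rpow_add hq0, ← Nat.cast_mul, Real.rpow_natCast, mul_comm (n : ℝ) ν,
      Real.rpow_mul_natCast hq0.le]
  rw [h1, h2, jacksonCoeff, div_eq_mul_one_div (q ^ ν) 4, mul_pow]
  push_cast
  ring

/-- The imaginary part of (log z)/2 lies in (-π/2, π/2], so it is the principal logarithm of √z;
dividing by 2 subtracts log 2. No branch correction arises and the exponents add up. -/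
theorem cpow_mul_sqrt_cpow {z : ℂ} (hz : z ≠ 0) (ν : ℝ) :
    z ^ (1 - (ν : ℂ) / 2) * (z ^ (1 / 2 : ℂ) / 2) ^ (ν : ℂ) = (((2 : ℝ) ^ ν : ℝ) : ℂ)⁻¹ * z := by
  have hlog : Complex.log (z ^ (1 / 2 : ℂ)) = Complex.log z * (1 / 2) := by
    rw [Complex.cpow_def_of_ne_zero hz]
    have h1 := Complex.neg_pi_lt_log_im z
    have h2 := Complex.log_im_le_pi z
    have him : (Complex.log z * (1 / 2)).im = (Complex.log z).im / 2 := by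
      rw [show Complex.log z * (1 / 2) = Complex.log z / (2 : ℕ) by push_cast; ring,
        Complex.div_natCast_im]
      norm_num
    have := Real.pi_pos
    refine Complex.log_exp ?_ ?_ <;> rw [him] <;> linarith
  have hsne : z ^ (1 / 2 : ℂ) ≠ 0 := by simp [Complex.cpow_eq_zero_iff, hz]
  have hlog2 : Complex.log (z ^ (1 / 2 : ℂ) / 2) =
      -(Real.log 2 : ℂ) + Complex.log z * (1 / 2) := by
    have h := Complex.log_ofReal_mul (r := (2 : ℝ)⁻¹) (by norm_num) hsne
    rw [Real.log_inv, hlog] at h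
    rw [div_eq_inv_mul]
    simpa using h
  have hs2 : z ^ (1 / 2 : ℂ) / 2 ≠ 0 := div_ne_zero hsne two_ne_zero
  rw [Complex.cpow_def_of_ne_zero hz, Complex.cpow_def_of_ne_zero hs2, hlog2,
    Real.rpow_def_of_pos two_pos, Complex.ofReal_exp, ← Complex.exp_neg, ← Complex.exp_add]
  nth_rewrite 3 [← Complex.exp_log hz]
  rw [← Complex.exp_add]
  congr 1
  push_cast
  ring

theorem hJackson_eq (hν : -1 < ν) (hq0 : 0 < q) (hq1 : q < 1) :
    hJackson ν q = fun z => z * realPowerSeries (jacksonCoeff ν q) z := by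
  funext z
  by_cases hz : z = 0
  · subst hz
    rw [zero_mul, hJackson]
    -- At z = 0 the prefactor takes the default value 0 unless its exponent vanishes, that is ν = 2.
    -- Then it is 1, and the Bessel factor vanishes because all its exponents 2n + 2 are nonzero.
    by_cases hν2 : ν = 2
    · have : jacksonBessel ν q (0 ^ (1 / 2 : ℂ)) = 0 := by
        rw [jacksonBessel, hν2]
        refine mul_eq_zero_of_right _ ?_
        rw [show (0 : ℂ) ^ (1 / 2 : ℂ) = 0 by simp]
        have : ∀ n : ℕ, (0 : ℂ) ^ (2 * (n : ℂ) + ((2 : ℝ) : ℂ)) = 0 := by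
          intro n
          rw [Complex.zero_cpow]
          intro h
          have : ((2 * (n : ℝ) + 2 : ℝ) : ℂ) = 0 := by push_cast at h ⊢; exact h
          have := Complex.ofReal_eq_zero.1 this
          have : (0 : ℝ) < 2 * n + 2 := by positivity
          linarith
        simp only [zero_div, this, mul_zero, zero_mul, tsum_zero]
      rw [this, mul_zero]
    · have : (1 - (ν : ℂ) / 2) ≠ 0 := by
        intro h
        apply hν2
        have h' : (ν : ℂ) = ((2 : ℝ) : ℂ) := by push_cast; linear_combination (-2) * h
        exact Complex.ofReal_injective h'
      rw [Complex.zero_cpow this, mul_zero, zero_mul]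
  · have hsne : z ^ (1 / 2 : ℂ) ≠ 0 := by simp [Complex.cpow_eq_zero_iff, hz]
    have hsq : (z ^ (1 / 2 : ℂ)) ^ 2 = z := by
      rw [one_div]; exact Complex.cpow_nat_inv_pow z two_ne_zero
    rw [hJackson, jacksonBessel_eq hq0 hsne, hsq]
    have hb0 := Real.rpow_pos_of_pos hq0 (ν + 1)
    have hb1 := rpow_add_one_lt_one hν hq0 hq1
    have hA := qPochhammerInf_ne_zero hq0 hq1 hq0.le hq1
    have hB := qPochhammerInf_ne_zero hq0 hq1 hb0.le hb1
    have hconst : ((qBesselConst ν q : ℝ) : ℂ) *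
        ((qPochhammerInf (q ^ (ν + 1)) q / qPochhammerInf q q : ℝ) : ℂ) = 1 := by
      rw [← Complex.ofReal_mul, qBesselConst]
      rw [div_mul_div_comm, mul_comm, div_self (mul_ne_zero hB hA), Complex.ofReal_one]
    have h2 : (((2 : ℝ) ^ ν : ℝ) : ℂ) ≠ 0 :=
      Complex.ofReal_ne_zero.2 (Real.rpow_pos_of_pos two_pos ν).ne'
    have hpow := cpow_mul_sqrt_cpow hz ν
    rw [Complex.ofReal_mul]
    calc _ = ((qBesselConst ν q : ℝ) : ℂ) *
        ((qPochhammerInf (q ^ (ν + 1)) q / qPochhammerInf q q : ℝ) : ℂ) * (((2 : ℝ) ^ ν : ℝ) : ℂ) *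
        (z ^ (1 - (ν : ℂ) / 2) * (z ^ (1 / 2 : ℂ) / 2) ^ (ν : ℂ)) *
        realPowerSeries (jacksonCoeff ν q) z := by ring
      _ = _ := by
        rw [hconst, hpow, one_mul, ← mul_assoc, mul_inv_cancel₀ h2, one_mul]

/-- The coefficients of the derivative of `h_ν^{(2)}(·;q)`. -/
noncomputable def jacksonDerivCoeff (ν q : ℝ) (n : ℕ) : ℝ := ((n : ℝ) + 1) * jacksonCoeff ν q n

theorem jacksonDeriv_eq (hν : -1 < ν) (hq0 : 0 < q) (hq1 : q < 1) (z : ℂ) :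
    realPowerSeries (jacksonDerivCoeff ν q) z = realPowerSeries (jacksonCoeff ν q) z +
      z * realPowerSeries (fun n => ((n : ℝ) + 1) * jacksonCoeff ν q (n + 1)) z :=
  have h := isAlternatingRapid_jacksonCoeff hν hq0 hq1
  realPowerSeries_succ_mul (fun _ hR => h.summable hR) (fun _ hR => h.succ_mul.summable hR) z

theorem hasDerivAt_jacksonSeries (hν : -1 < ν) (hq0 : 0 < q) (hq1 : q < 1) (z : ℂ) :
    HasDerivAt (realPowerSeries (jacksonCoeff ν q))
      (realPowerSeries (fun n => ((n : ℝ) + 1) * jacksonCoeff ν q (n + 1)) z) z :=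
  hasDerivAt_realPowerSeries
    (fun _ hR => (isAlternatingRapid_jacksonCoeff hν hq0 hq1).summable hR) z

theorem hasDerivAt_hJackson (hν : -1 < ν) (hq0 : 0 < q) (hq1 : q < 1) (z : ℂ) :
    HasDerivAt (hJackson ν q) (realPowerSeries (jacksonDerivCoeff ν q) z) z := by
  rw [hJackson_eq hν hq0 hq1, jacksonDeriv_eq hν hq0 hq1]
  exact ((hasDerivAt_id z).mul (hasDerivAt_jacksonSeries hν hq0 hq1 z)).congr_deriv (by simp)

/-- The root equation of the theorem is the vanishing of `h_ν^{(2)}'`. -/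
theorem rootEquation_iff (hν : -1 < ν) (hq0 : 0 < q) (hq1 : q < 1) {r : ℝ} (hr : 0 < r) :
    ((√r : ℝ) : ℂ) * deriv (jacksonBessel ν q) ((√r : ℝ) : ℂ)
          - ((ν : ℂ) - 2) * jacksonBessel ν q ((√r : ℝ) : ℂ) = 0 ↔
      realPowerSeries (jacksonDerivCoeff ν q) r = 0 := by
  have hb0 := Real.rpow_pos_of_pos hq0 (ν + 1)
  have hb1 := rpow_add_one_lt_one hν hq0 hq1
  have hA := qPochhammerInf_ne_zero hq0 hq1 hq0.le hq1
  have hB := qPochhammerInf_ne_zero hq0 hq1 hb0.le hb1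
  have hsr := Real.sqrt_pos.2 hr
  set w : ℂ := ((√r : ℝ) : ℂ) with hw
  have hw0 : w ≠ 0 := Complex.ofReal_ne_zero.2 hsr.ne'
  have hw2 : w ^ 2 = r := by rw [hw, ← Complex.ofReal_pow, Real.sq_sqrt hr.le]
  have hslit : w / 2 ∈ Complex.slitPlane := by
    rw [hw, show ((√r : ℝ) : ℂ) / 2 = ((√r / 2 : ℝ) : ℂ) by push_cast; ring,
      Complex.ofReal_mem_slitPlane]
    positivity
  have hwn : w / 2 ≠ 0 := div_ne_zero hw0 two_ne_zero
  obtain ⟨K, hK⟩ : ∃ K : ℂ, K = ((qPochhammerInf (q ^ (ν + 1)) q / qPochhammerInf q q : ℝ) : ℂ) :=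
    ⟨_, rfl⟩
  have hK0 : K ≠ 0 := by
    rw [hK]; exact Complex.ofReal_ne_zero.2 (div_ne_zero hB hA)
  obtain ⟨D, hD⟩ : ∃ D, D = realPowerSeries (fun n => ((n : ℝ) + 1) * jacksonCoeff ν q (n + 1)) r :=
    ⟨_, rfl⟩
  have hd1 : HasDerivAt (fun v : ℂ => (v / 2) ^ (ν : ℂ))
      ((ν : ℂ) * (w / 2) ^ ((ν : ℂ) - 1) * (1 / 2)) w :=
    ((hasDerivAt_id w).div_const 2).cpow_const hslit
  have hd2 : HasDerivAt (fun v : ℂ => realPowerSeries (jacksonCoeff ν q) (v ^ 2))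
      (D * (2 * w)) w := by
    have h := hasDerivAt_jacksonSeries hν hq0 hq1 (w ^ 2)
    have h2 : HasDerivAt (fun v : ℂ => v ^ 2) (2 * w) w := by simpa using hasDerivAt_pow 2 w
    have := h.comp w h2
    rw [hw2, ← hD] at this
    exact this
  have hd : HasDerivAt (jacksonBessel ν q) (K * ((ν : ℂ) * (w / 2) ^ ((ν : ℂ) - 1) * (1 / 2) *
      realPowerSeries (jacksonCoeff ν q) (w ^ 2) + (w / 2) ^ (ν : ℂ) * (D * (2 * w)))) w := by
    refine ((hd1.mul hd2).const_mul K).congr_of_eventuallyEq ?_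
    filter_upwards [isOpen_ne.mem_nhds hw0] with v hv
    rw [jacksonBessel_eq hq0 hv, hK]
    rfl
  have hP : (w / 2) ^ (ν : ℂ) ≠ 0 := by simp [Complex.cpow_eq_zero_iff, hwn]
  -- With r = w², w J'(w) = K (w/2)^ν (ν f(r) + 2 r f'(r)); subtracting (ν - 2) J(w) leaves 2 K
  -- (w/2)^ν (f(r) + r f'(r)).
  have key : w * deriv (jacksonBessel ν q) w - ((ν : ℂ) - 2) * jacksonBessel ν q w =
      2 * K * (w / 2) ^ (ν : ℂ) * realPowerSeries (jacksonDerivCoeff ν q) r := by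
    rw [hd.deriv, jacksonBessel_eq hq0 hw0, ← hK, jacksonDeriv_eq hν hq0 hq1, ← hD,
      Complex.cpow_sub _ _ hwn, Complex.cpow_one, ← hw2]
    field_simp
    ring
  rw [key]
  simp [hK0, hP]

end

/-! ### The first three power sums of h', the radius and the bounds -/

section

variable {ν q : ℝ}

theorem jacksonCoeff_one (hν : -1 < ν) (hq0 : 0 < q) (hq1 : q < 1) :
    jacksonCoeff ν q 1 = -(q ^ (ν + 1) / (4 * ((1 - q) * (1 - q ^ (ν + 1))))) := by
  simpa [jacksonCoeff_zero] using jacksonCoeff_succ hν hq0 hq1 0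

theorem powerSum_zero (hν : -1 < ν) (hq0 : 0 < q) (hq1 : q < 1) {s : ℕ → ℝ}
    (h : IsLogDeriv (jacksonDerivCoeff ν q) s) :
    s 0 = q ^ (ν + 1) / (2 * (1 - q) * (1 - q ^ (ν + 1))) := by
  have h0 := h.eq_sub (by simp [jacksonDerivCoeff, jacksonCoeff_zero]) 0
  simp only [jacksonDerivCoeff, zero_add, range_zero, sum_empty, jacksonCoeff_one hν hq0 hq1] at h0
  have hb1 := rpow_add_one_lt_one hν hq0 hq1
  rw [h0]
  generalize q ^ (ν + 1) = b at *
  have : 1 - q ≠ 0 := by linarith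
  have : 1 - b ≠ 0 := by linarith
  push_cast
  field_simp
  ring

theorem powerSum_one (hν : -1 < ν) (hq0 : 0 < q) (hq1 : q < 1) {s : ℕ → ℝ}
    (h : IsLogDeriv (jacksonDerivCoeff ν q) s) :
    s 1 = (q ^ (ν + 1)) ^ 2 * (2 * q - 2 * (q ^ (ν + 1) * q) + q ^ (ν + 1) * q ^ 2 - 3 * q ^ 2 + 2) /
      (8 * (1 - q) ^ 2 * (1 - q ^ (ν + 1)) ^ 2 * (1 + q) * (1 - q ^ (ν + 1) * q)) := by
  have h0 := h.eq_sub (by simp [jacksonDerivCoeff, jacksonCoeff_zero]) 1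
  have hc2 := jacksonCoeff_succ hν hq0 hq1 1
  simp only [jacksonDerivCoeff, zero_add, range_one, sum_singleton, Nat.sub_self,
    powerSum_zero hν hq0 hq1 h, hc2, jacksonCoeff_one hν hq0 hq1, pow_one] at h0
  have hb0 := Real.rpow_pos_of_pos hq0 (ν + 1)
  have hb1 := rpow_add_one_lt_one hν hq0 hq1
  rw [h0]
  generalize q ^ (ν + 1) = b at *
  have e1 : 1 - q * q = (1 - q) * (1 + q) := by ring
  rw [e1]
  have : 1 - q ≠ 0 := by linarith
  have : 1 - b ≠ 0 := by linarith
  have : 1 + q ≠ 0 := by linarith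
  have : 1 - b * q ≠ 0 := by nlinarith
  obtain ⟨U, hU⟩ : ∃ U, U = 1 - b * q := ⟨_, rfl⟩
  rw [← hU] at this ⊢
  push_cast
  field_simp
  rw [hU]
  ring

theorem powerSum_two (hν : -1 < ν) (hq0 : 0 < q) (hq1 : q < 1) {s : ℕ → ℝ}
    (h : IsLogDeriv (jacksonDerivCoeff ν q) s) {b : ℝ} (hb : b = q ^ (ν + 1)) :
    s 2 = -(b ^ 3 * (4 * (b * q) + 3 * (b * q ^ 2) + 7 * (b * q ^ 3) - 6 * (b * q ^ 4) -
      5 * (b * q ^ 5) + 3 * (b * q ^ 6) - 4 * (b ^ 2 * q ^ 3) + b ^ 2 * q ^ 4 +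
      (b ^ 2 * q ^ 5 - b ^ 2 * q ^ 6 - 8 * q + q ^ 2 + 5 * q ^ 3 + 9 * q ^ 4 - 6 * q ^ 6 - 4))) /
      (32 * (1 - q) ^ 3 * (1 - b) ^ 3 * (1 + q) * (1 - b * q) * (1 - b * q ^ 2) *
        (1 + q + q ^ 2)) := by
  have h0 := h.eq_sub (by simp [jacksonDerivCoeff, jacksonCoeff_zero]) 2
  have hc2 := jacksonCoeff_succ hν hq0 hq1 1
  have hc3 := jacksonCoeff_succ hν hq0 hq1 2
  rw [sum_range_succ, sum_range_one] at h0
  simp only [jacksonDerivCoeff, zero_add, Nat.reduceAdd, Nat.reduceSub,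
    powerSum_zero hν hq0 hq1 h, powerSum_one hν hq0 hq1 h, hc3, hc2, jacksonCoeff_one hν hq0 hq1,
    pow_one] at h0
  have hb0 := Real.rpow_pos_of_pos hq0 (ν + 1)
  have hb1 := rpow_add_one_lt_one hν hq0 hq1
  rw [h0]
  simp only [← hb] at hb0 hb1 ⊢
  have e1 : 1 - q * q = (1 - q) * (1 + q) := by ring
  have e2 : 1 - q * q ^ 2 = (1 - q) * (1 + q + q ^ 2) := by ring
  rw [e1, e2]
  have h1 : 1 - q ≠ 0 := by linarith
  have h2 : 1 - b ≠ 0 := by linarith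
  have h3 : 1 + q ≠ 0 := by linarith
  have h4 : 1 - b * q ≠ 0 := by nlinarith
  have h5 : 1 - b * q ^ 2 ≠ 0 := by nlinarith
  have h6 : 1 + q + q ^ 2 ≠ 0 := by positivity
  obtain ⟨U, hU⟩ : ∃ U, U = 1 - b * q := ⟨_, rfl⟩
  obtain ⟨V, hV⟩ : ∃ V, V = 1 - b * q ^ 2 := ⟨_, rfl⟩
  obtain ⟨W, hW⟩ : ∃ W, W = 1 + q + q ^ 2 := ⟨_, rfl⟩
  rw [← hU, ← hV, ← hW]
  rw [← hU] at h4
  rw [← hV] at h5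
  rw [← hW] at h6
  push_cast
  field_simp
  rw [hV, hW]
  ring

theorem exists_hasTopReciprocalZero_jackson (hν : -1 < ν) (hq0 : 0 < q) (hq1 : q < 1) :
    (∃ s u, HasTopReciprocalZero (jacksonCoeff ν q) s u) ∧
      ∃ σ t, HasTopReciprocalZero (jacksonDerivCoeff ν q) σ t :=
  have hlim := isPosRootedLimit_jacksonCoeff hν hq0 hq1
  have hrap := isAlternatingRapid_jacksonCoeff hν hq0 hq1
  ⟨hlim.exists_hasTopReciprocalZero hrap, hlim.succ_mul.exists_hasTopReciprocalZero hrap.succ_mul⟩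

/-- For r > 1/t the disk contains 1/t, where h' and hence the quotient vanish. The radius 1/t itself
is admissible because the disk is open. -/
theorem starlikeRadii_hJackson (hν : -1 < ν) (hq0 : 0 < q) (hq1 : q < 1) {σ : ℕ → ℝ} {t : ℝ}
    (h : HasTopReciprocalZero (jacksonDerivCoeff ν q) σ t) :
    starlikeRadii (hJackson ν q) = Set.Ioc 0 t⁻¹ := by
  obtain ⟨⟨s, u, hf⟩, -⟩ := exists_hasTopReciprocalZero_jackson hν hq0 hq1
  have hderiv := hasDerivAt_hJackson hν hq0 hq1
  ext r
  constructor
  · rintro ⟨hr0, -, hr⟩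
    refine ⟨hr0, not_lt.1 fun hlt => ?_⟩
    have htinv := inv_pos.2 h.pos
    have := hr ((t⁻¹ : ℝ) : ℂ) (by
      rwa [mem_ball_zero_iff, Complex.norm_real, Real.norm_of_nonneg htinv.le])
      (Complex.ofReal_ne_zero.2 htinv.ne')
    rw [(hderiv _).deriv, h.eq_zero, mul_zero, zero_div, Complex.zero_re] at this
    exact lt_irrefl _ this
  · rintro ⟨hr0, hr⟩
    refine ⟨hr0, ⟨fun z _ => (hderiv z).differentiableAt.differentiableWithinAt, ?_, ?_⟩, ?_⟩
    · simp [hJackson_eq hν hq0 hq1]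
    · rw [(hderiv 0).deriv, h.apply_zero]
    · intro z hz hz0
      rw [mem_ball_zero_iff] at hz
      rw [(hderiv z).deriv, hJackson_eq hν hq0 hq1, mul_div_mul_left _ _ hz0]
      exact hf.re_div_pos h (hz.trans_le hr)

end

theorem theorem3 (ν q : ℝ) (hν : -1 < ν) (hq0 : 0 < q) (hq1 : q < 1) :
    IsLUB (starlikeRadii (hJackson ν q)) (radiusOfStarlikeness (hJackson ν q)) ∧
    IsLeast {r : ℝ | 0 < r ∧
        ((√r : ℝ) : ℂ) * deriv (jacksonBessel ν q) ((√r : ℝ) : ℂ)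
          - ((ν : ℂ) - 2) * jacksonBessel ν q ((√r : ℝ) : ℂ) = 0}
      (radiusOfStarlikeness (hJackson ν q)) ∧
    2 * (1 - q) * (1 - q ^ (ν + 1)) / q ^ (ν + 1) < radiusOfStarlikeness (hJackson ν q) ∧
    radiusOfStarlikeness (hJackson ν q) <
      4 * (q ^ (ν + 1) - 1) * (q ^ (ν + 2) - 1) * (1 - q ^ 2) /
        (q ^ (ν + 1) * boundPoly ν q) ∧
    √(8 * (q ^ (ν + 1) - 1) ^ 2 * (1 - q ^ (ν + 2)) * (q - 1) ^ 2 * (q + 1) /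
        (q ^ (2 * ν + 2) * boundPoly ν q)) < radiusOfStarlikeness (hJackson ν q) ∧
    radiusOfStarlikeness (hJackson ν q) <
      4 * (q ^ (ν + 1) - 1) * (q ^ (ν + 3) - 1) * (q ^ 3 - 1) / q ^ (ν + 1)
        * qTwoStar ν q := by
  obtain ⟨-, σ, t, h⟩ := exists_hasTopReciprocalZero_jackson hν hq0 hq1
  have ht := h.pos
  have htinv := inv_pos.2 ht
  have hset := starlikeRadii_hJackson hν hq0 hq1 h
  have hr : radiusOfStarlikeness (hJackson ν q) = t⁻¹ := by
    rw [radiusOfStarlikeness, hset, csSup_Ioc htinv]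
  have hb0 := Real.rpow_pos_of_pos hq0 (ν + 1)
  have hb1 := rpow_add_one_lt_one hν hq0 hq1
  obtain ⟨b, hb⟩ : ∃ b, b = q ^ (ν + 1) := ⟨_, rfl⟩
  have hpow : ∀ k : ℕ, q ^ (ν + (k + 1 : ℕ)) = b * q ^ k := by
    intro k
    rw [hb, ← Real.rpow_natCast, ← Real.rpow_add hq0]
    congr 1
    push_cast
    ring
  have hpow2 : ∀ k : ℕ, q ^ (2 * ν + (k + 2 : ℕ)) = b ^ 2 * q ^ k := by
    intro k
    rw [hb, ← Real.rpow_natCast, ← Real.rpow_natCast, ← Real.rpow_mul hq0.le, ← Real.rpow_add hq0]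
    congr 1
    push_cast
    ring
  have p2 : q ^ (ν + 2) = b * q := by simpa using hpow 1
  have p3 : q ^ (ν + 3) = b * q ^ 2 := by simpa using hpow 2
  have p4 : q ^ (ν + 4) = b * q ^ 3 := by simpa using hpow 3
  have p5 : q ^ (ν + 5) = b * q ^ 4 := by simpa using hpow 4
  have p6 : q ^ (ν + 6) = b * q ^ 5 := by simpa using hpow 5
  have p7 : q ^ (ν + 7) = b * q ^ 6 := by simpa using hpow 6
  have r2 : q ^ (2 * ν + 2) = b ^ 2 := by simpa using hpow2 0
  have r5 : q ^ (2 * ν + 5) = b ^ 2 * q ^ 3 := by simpa using hpow2 3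
  have r6 : q ^ (2 * ν + 6) = b ^ 2 * q ^ 4 := by simpa using hpow2 4
  have r7 : q ^ (2 * ν + 7) = b ^ 2 * q ^ 5 := by simpa using hpow2 5
  have r8 : q ^ (2 * ν + 8) = b ^ 2 * q ^ 6 := by simpa using hpow2 6
  have hσ0 := powerSum_zero hν hq0 hq1 h.logDeriv
  have hσ1 := powerSum_one hν hq0 hq1 h.logDeriv
  have hσ2 := powerSum_two hν hq0 hq1 h.logDeriv hb
  rw [← hb] at hσ0 hσ1 hb0 hb1
  have hpos : ∀ m, 0 < σ m := fun m => (pow_pos ht _).trans_le (h.pow_le m)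
  -- The upper Euler–Rayleigh bounds.
  have hratio : ∀ m ≤ 1, t⁻¹ < σ m / σ (m + 1) := by
    intro m hm
    rw [inv_eq_one_div, div_lt_div_iff₀ ht (hpos _), one_mul, mul_comm]
    exact h.succ_lt m hm
  have h1 : 0 < 1 - q := by linarith
  have h2 : 0 < 1 - b := by linarith
  have h3 : 0 < 1 + q := by linarith
  have h4 : 0 < 1 - b * q := by nlinarith
  have h5 : 0 < 1 - b * q ^ 2 := by nlinarith
  have h6 : 0 < 1 + q + q ^ 2 := by positivity
  have hBP : boundPoly ν q = 2 * q - 2 * (b * q) + b * q ^ 2 - 3 * q ^ 2 + 2 := by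
    rw [boundPoly, p2, p3]
  have hCD : boundDenomC ν q + boundDenomD ν q =
      4 * (b * q) + 3 * (b * q ^ 2) + 7 * (b * q ^ 3) - 6 * (b * q ^ 4) -
      5 * (b * q ^ 5) + 3 * (b * q ^ 6) - 4 * (b ^ 2 * q ^ 3) + b ^ 2 * q ^ 4 +
      (b ^ 2 * q ^ 5 - b ^ 2 * q ^ 6 - 8 * q + q ^ 2 + 5 * q ^ 3 + 9 * q ^ 4 - 6 * q ^ 6 - 4) := by
    rw [boundDenomC, boundDenomD, p2, p3, p4, p5, p6, p7, r5, r6, r7, r8]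
  rw [← hBP] at hσ1
  rw [← hCD] at hσ2
  -- That the denominators do not vanish is read off from the positivity of the power sums σ 1 and σ
  -- 2, so no polynomial inequality in q and b is needed.
  have hBP0 : boundPoly ν q ≠ 0 := by
    intro h0
    have := hpos 1
    rw [hσ1, h0] at this
    simp at this
  have hCD0 : boundDenomC ν q + boundDenomD ν q ≠ 0 := by
    intro h0
    have := hpos 2
    rw [hσ2, h0] at this
    simp at this
  rw [hr]
  refine ⟨?_, ⟨⟨htinv, ?_⟩, ?_⟩, ?_, ?_, ?_, ?_⟩
  · rw [hset]; exact isLUB_Ioc htinv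
  · rw [rootEquation_iff hν hq0 hq1 htinv]; exact h.eq_zero
  · rintro r ⟨hr0, hroot⟩
    rw [rootEquation_iff hν hq0 hq1 hr0] at hroot
    exact h.exists_root hr0.le (by rw [hroot, Complex.zero_re])
  · have hlt := inv_strictAnti₀ ht h.lt_zero
    rw [← hb]
    refine lt_of_eq_of_lt ?_ hlt
    rw [hσ0, inv_div]
  · convert hratio 0 (by norm_num) using 1
    rw [zero_add, hσ0, hσ1, p2, ← hb]
    generalize boundPoly ν q = P at *
    field_simp
    ring
  · rw [Real.sqrt_lt' htinv]
    have hlt := inv_strictAnti₀ (pow_pos ht 2) h.sq_lt_one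
    rw [inv_pow]
    refine lt_of_eq_of_lt ?_ hlt
    rw [hσ1, inv_div, p2, r2, ← hb]
    generalize boundPoly ν q = P at *
    field_simp
    ring
  · convert hratio 1 le_rfl using 1
    rw [hσ1, hσ2, qTwoStar, p3, ← hb]
    generalize boundPoly ν q = P at *
    generalize boundDenomC ν q + boundDenomD ν q = Q at *
    field_simp
    ring
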